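/- Let $N\ge 1$, $S>0$, $K(y)=e^{|y|^2/4}$ on $\mathbb R^N$, let $L^2(K)$ be the space of $f$ with $|f|_{L^2(K)}^2=\int |f|^2K\,dy<\infty$, and let $H^1(K)$ be the space of $f\in L^2(K)$ with weak gradient in $L^2(K)^N$. Let $A\in L^\infty(\mathbb R^N\times(0,S))$, $B\in L^\infty(\mathbb R^N\times(0,S))^N$, let $\mathcal O,\mathcal O_1,\dots,\mathcal O_n\subset\mathbb R^N$ be open, and put $\mathcal O'(s)=e^{-s/2}\mathcal O$, $\mathcal O_i'(s)=e^{-s/2}\mathcal O_i$. Write $\mathcal H_0=L^2(0,S;L^2(K))$ and $\mathcal H=\mathcal H_0^{\,n}$. For $v_0\in L^2(K)$, $g\in\mathcal H_0$ and $\mathbf h=(h_1,\dots,h_n)\in\mathcal H$ consider the state equation $$v_s-\tfrac1K\operatorname{div}(K\nabla v)+Av+B\cdot\nabla v-\tfrac N2 v=g\,\chi_{\mathcal O'}+\sum_{i=1}^n h_i\,\chi_{\mathcal O_i'}\ \text{ in }\mathbb R^N\times(0,S),\qquad v(0)=v_0 .$$ It has exactly one weak solution $v\in C([0,S];L^2(K))\cap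 L^2(0,S;H^1(K))$ with $v_s\in L^2(0,S;H^{-1}(K))$; write $v(S;v_0,g,\mathbf h)$ for its final state. Let $L_ih_i$ be the final state when $v_0=0$, $g=0$ and $h_i$ is the only control; then each $L_i$ is a bounded linear operator $\mathcal H_0\to L^2(K)$. Let $|D_{y,s}|=e^{-(N+2)s/2}$ and $|D_y|=e^{-NS/2}$ be the Jacobian determinants of $(x,t)\mapsto(y,s)=\big(\tfrac{x}{\sqrt{1+t}},\log(1+t)\big)$ and of $x\mapsto y$ at the final time $s=S$. For $\alpha_i>0$, $0\le\rho_i\in L^\infty(\mathbb R^N)$ and $v^S\in L^2(K)$ define $$J_i(g,\mathbf h)=\frac12\int_0^S\!\!\int_{\mathcal O_i'(s)}|D_{y,s}|\,h_i^2\,K\,dy\,ds+\frac{\alpha_i}2\int_{\mathbb R^N}|D_y|\,\rho_i^2\,|v(S;v_0,g,\mathbf h)-v^S|^2K\,dy ,$$ $$(\mathfrak L\mathbf h)_i=|D_{y,s}|\,h_i+\alpha_iL_i^*\Big(\rho_i^2|D_y|\sum_{j=1}^nL_jh_j\Big),\qquad i=1,\dots,n .$$ A Nash equilibrium (for given $v_0,v^S,g$)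 is an $\mathbf h\in\mathcal H$ such that, for every $i$, $J_i(g,\mathbf h)$ does not decrease when $h_i$ alone is replaced by any $\bar h_i\in\mathcal H_0$. Theorem. There is $\varepsilon>0$, depending only on $N,n,S,A,B$ and the sets $\mathcal O,\mathcal O_i$, such that whenever $$\alpha_i\,|D_y|\,|\rho_i|_\infty^2\le\varepsilon\qquad\text{for all } i=1,\dots,n,$$ the following hold. (1) $\mathfrak L$ is coercive on $\mathcal H$: there is $c>0$ with $(\mathfrak L\mathbf h,\mathbf h)_{\mathcal H}\ge c\,|\mathbf h|_{\mathcal H}^2$ for all $\mathbf h\in\mathcal H$. (2) $\mathfrak L$ is invertible, with bounded inverse. (3) For all $v_0,v^S\in L^2(K)$ and $g\in\mathcal H_0$, the solution $\mathbf h$ of $\mathfrak L\mathbf h=\xi$, where $\xi_i=\alpha_iL_i^*\big(\rho_i^2|D_y|(v^S-v(S;v_0,g,0))\big)$, is a Nash equilibrium for $J_1,\dots,J_n$ and each $h_i$ vanishes a.e. outside $\{(y,s):y\in\mathcal O_i'(s)\}$. It is unique as a control acting on the regions $\mathcal O_i'$: an $\mathbf h'\in\mathcal H$ is a Nash equilibrium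 if and only if, for every $i$, $h_i'=h_i$ a.e. on $\{(y,s): 0<s<S,\ y\in\mathcal O_i'(s)\}$. -/

import Mathlib

open MeasureTheory Set
open scoped ENNReal Pointwise ContDiff

noncomputable section

namespace StackelbergNash

/-! ### Weighted spaces -/

/-- The space `ℝ^N` with its Euclidean norm. -/
abbrev Space (N : ℕ) : Type := EuclideanSpace ℝ (Fin N)

/-- The measure `K(y) dy` on `ℝ^N`, with the weight `K(y) = exp (|y|² / 4)`. It has the same null
sets as Lebesgue measure. -/
def measK (N : ℕ) : Measure (Space N) :=
  (volume : Measure (Space N)).withDensity fun y => ENNReal.ofReal (Real.exp (‖y‖ ^ 2 / 4))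

/-- The Hilbert space `L²(K)`. -/
abbrev L2K (N : ℕ) : Type := Lp ℝ 2 (measK N)

/-- The space `L^∞(ℝ^N)`; since `K dy` and `dy` have the same null sets, its norm is the usual
essential supremum. -/
abbrev LinftyK (N : ℕ) : Type := Lp ℝ ∞ (measK N)

/-- Lebesgue measure on the time interval `(0,S)`. -/
abbrev timeMeas (S : ℝ) : Measure ℝ := volume.restrict (Ioo 0 S)

/-- The space of controls `L²(0,S; L²(K))`. -/
abbrev Control (N : ℕ) (S : ℝ) : Type := Lp (L2K N) 2 (timeMeas S)

/-- The Hilbert space `(L²(0,S; L²(K)))^n`. -/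
abbrev Controls (N : ℕ) (S : ℝ) (n : ℕ) : Type := PiLp 2 fun _ : Fin n => Control N S

/-- `u ∈ L²(K)` has the weak (distributional) partial derivatives `∂u/∂y_j = G j ∈ L²(K)`; that is,
`u ∈ H¹(K)` with gradient `G`. -/
def HasWeakGrad {N : ℕ} (u : L2K N) (G : Fin N → L2K N) : Prop :=
  ∀ η : Space N → ℝ, ContDiff ℝ ∞ η → HasCompactSupport η → ∀ j : Fin N,
    ∫ y, u y * fderiv ℝ η y (EuclideanSpace.single j 1) = -∫ y, G j y * η y

/-! ### The state equation -/

/-- `v` is the weak solution of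
`v_s + L v + A v + B · ∇v - (N/2) v = φ` in `ℝ^N × (0,S)`, `v(0) = v₀`,
where `L v = -(1/K) div (K ∇v)`, so that `(L v, ψ) = ∫ ∇v · ∇ψ K dy` for `ψ ∈ H¹(K)`:
`v ∈ C([0,S]; L²(K)) ∩ L²(0,S; H¹(K))` and the equation, integrated over `(0,s)`, holds when tested
with every `ψ ∈ H¹(K)`. (The identity says that `v_s`, as an element of the dual `H⁻¹(K)`, is
`φ - L v - A v - B · ∇v + (N/2) v`, which is in `L²(0,S; H⁻¹(K))`.)
The values of `v` outside `[0,S]` are irrelevant. -/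
def IsWeakSolution {N : ℕ} (S : ℝ) (A : ℝ → Space N → ℝ) (B : ℝ → Space N → Space N)
    (v₀ : L2K N) (φ : ℝ → Space N → ℝ) (v : ℝ → L2K N) : Prop :=
  ContinuousOn v (Icc 0 S) ∧ v 0 = v₀ ∧
  ∃ G : ℝ → Fin N → L2K N,
    MemLp G 2 (timeMeas S) ∧
    (∀ᵐ s ∂(timeMeas S), HasWeakGrad (v s) (G s)) ∧
    ∀ (ψ : L2K N) (Gψ : Fin N → L2K N), HasWeakGrad ψ Gψ → ∀ s ∈ Icc 0 S,
      inner ℝ (v s) ψ +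
        ∫ τ in (0 : ℝ)..s,
          ((∑ j, inner ℝ (G τ j) (Gψ j))
            + (∫ y, A τ y * v τ y * ψ y ∂(measK N))
            + (∫ y, (∑ j, B τ y j * G τ j y) * ψ y ∂(measK N))
            - (N : ℝ) / 2 * inner ℝ (v τ) ψ)
      = inner ℝ v₀ ψ + ∫ τ in (0 : ℝ)..s, ∫ y, φ τ y * ψ y ∂(measK N)

/-- The final state `v(S)` of the weak solution (meaningful when there is exactly one). -/
def finalState {N : ℕ} (S : ℝ) (A : ℝ → Space N → ℝ) (B : ℝ → Space N → Space N)
    (v₀ : L2K N) (φ : ℝ → Space N → ℝ) : L2K N :=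
  Classical.epsilon fun w => ∃ v, IsWeakSolution S A B v₀ φ v ∧ v S = w

/-- The region `U'(s) = e^{-s/2} U` in similarity variables. -/
def region {N : ℕ} (U : Set (Space N)) (s : ℝ) : Set (Space N) := Real.exp (-s / 2) • U

/-- The source `h χ_{U'}` generated by the control `h` acting on the moving region `U'(s)`. -/
def localize {N : ℕ} {S : ℝ} (U : Set (Space N)) (h : Control N S) : ℝ → Space N → ℝ :=
  fun s => (region U s).indicator (h s)

/-- The source `g χ_{O'} + ∑ h_i χ_{O_i'}` of the state equation. -/
def source {N n : ℕ} {S : ℝ} (O : Set (Space N)) (Oi : Fin n → Set (Space N))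
    (g : Control N S) (h : Fin n → Control N S) : ℝ → Space N → ℝ :=
  fun s y => localize O g s y + ∑ i, localize (Oi i) (h i) s y

/-! ### Jacobian determinants of the similarity variables -/

/-- `|D_{y,s}|`: the Jacobian determinant of `(x,t) ↦ (y,s) = (x / √(1+t), log (1+t))`, which is
`(1+t)^{-N/2} (1+t)^{-1} = e^{-(N+2)s/2}`. -/
def jacYS (N : ℕ) (s : ℝ) : ℝ := Real.exp (-((N : ℝ) + 2) * s / 2)

/-- `|D_y|`: the Jacobian determinant of `x ↦ y = x / √(1+T)` at the final time `T = e^S - 1`,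
which is `(1+T)^{-N/2} = e^{-NS/2}`. -/
def jacY (N : ℕ) (S : ℝ) : ℝ := Real.exp (-(N : ℝ) * S / 2)

theorem memLp_jacYS (N : ℕ) (S : ℝ) : MemLp (jacYS N) ∞ (timeMeas S) := by
  refine memLp_top_of_bound (by unfold jacYS; fun_prop) 1 ?_
  filter_upwards [ae_restrict_mem measurableSet_Ioo] with s hs
  rw [jacYS, Real.norm_eq_abs, Real.abs_exp, Real.exp_le_one_iff]
  have h := mul_nonneg (by positivity : (0 : ℝ) ≤ (N : ℝ) + 2) hs.1.le
  linarith

/-! ### The operator `𝔏` -/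

/-- Multiplication by a bounded function, as a bounded operator on `L²(μ; F)`. -/
def mulOp {X F : Type*} [MeasurableSpace X] {μ : Measure X} [NormedAddCommGroup F]
    [NormedSpace ℝ F] (m : Lp ℝ ∞ μ) : Lp F 2 μ →L[ℝ] Lp F 2 μ :=
  (ContinuousLinearMap.lsmul ℝ ℝ : ℝ →L[ℝ] F →L[ℝ] F).holderL μ ∞ 2 2 m

/-- The operator `k ↦ L_i^* (ρ_i² |D_y| k)` from `L²(K)` to `L²(0,S; L²(K))`. -/
def weightedAdjoint {N : ℕ} {S : ℝ} (L : Control N S →L[ℝ] L2K N) (ρ : LinftyK N) :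
    L2K N →L[ℝ] Control N S :=
  (ContinuousLinearMap.adjoint L) ∘L (jacY N S • (mulOp ρ ∘L mulOp ρ))

/-- The bounded operator `𝔏` on `(L²(0,S; L²(K)))^n`,
`(𝔏 h)_i = |D_{y,s}| h_i + α_i L_i^* (ρ_i² |D_y| ∑_j L_j h_j)`. -/
def nashOp {N n : ℕ} {S : ℝ} (L : Fin n → Control N S →L[ℝ] L2K N)
    (α : Fin n → ℝ) (ρ : Fin n → LinftyK N) : Controls N S n →L[ℝ] Controls N S n :=
  ((PiLp.continuousLinearEquiv 2 ℝ fun _ : Fin n => Control N S).symm :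
      (Fin n → Control N S) →L[ℝ] Controls N S n) ∘L
    ContinuousLinearMap.pi fun i =>
      mulOp ((memLp_jacYS N S).toLp (jacYS N)) ∘L PiLp.proj 2 (fun _ : Fin n => Control N S) i
      + α i • (weightedAdjoint (L i) (ρ i) ∘L
          ∑ j, L j ∘L PiLp.proj 2 (fun _ : Fin n => Control N S) j)

/-- The right-hand side `ξ_i = α_i L_i^* (ρ_i² |D_y| η)`. -/
def nashRhs {N n : ℕ} {S : ℝ} (L : Fin n → Control N S →L[ℝ] L2K N)
    (α : Fin n → ℝ) (ρ : Fin n → LinftyK N) (η : L2K N) : Controls N S n :=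
  WithLp.toLp 2 fun i => α i • weightedAdjoint (L i) (ρ i) η

/-! ### Costs and Nash equilibria -/

/-- The cost
`J_i(g,h) = ½ ∫₀^S ∫_{O_i'(s)} |D_{y,s}| h_i² K dy ds + (α_i/2) ∫ |D_y| ρ_i² |v(S;g,h) - v^S|² K dy`
of the `i`-th follower. -/
def cost {N n : ℕ} {S : ℝ} (A : ℝ → Space N → ℝ) (B : ℝ → Space N → Space N)
    (O : Set (Space N)) (Oi : Fin n → Set (Space N)) (α : Fin n → ℝ) (ρ : Fin n → LinftyK N)
    (v₀ vS : L2K N) (g : Control N S) (i : Fin n) (h : Fin n → Control N S) : ℝ :=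
  1 / 2 * (∫ s in Ioo 0 S, ∫ y in region (Oi i) s, jacYS N s * (h i s y) ^ 2 ∂(measK N))
  + α i / 2 * ∫ y, jacY N S * (ρ i y) ^ 2 *
      (finalState S A B v₀ (source O Oi g h) y - vS y) ^ 2 ∂(measK N)

/-- `h` is a Nash equilibrium: no follower can lower its cost by changing its own control. -/
def IsNash {N n : ℕ} {S : ℝ} (A : ℝ → Space N → ℝ) (B : ℝ → Space N → Space N)
    (O : Set (Space N)) (Oi : Fin n → Set (Space N)) (α : Fin n → ℝ) (ρ : Fin n → LinftyK N)
    (v₀ vS : L2K N) (g : Control N S) (h : Fin n → Control N S) : Prop :=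
  ∀ (i : Fin n) (k : Control N S),
    cost A B O Oi α ρ v₀ vS g i h ≤ cost A B O Oi α ρ v₀ vS g i (Function.update h i k)

end StackelbergNash

end

set_option linter.unusedSectionVars false

noncomputable section

namespace StackelbergNash

open scoped InnerProductSpace BoundedContinuousFunction
open ContinuousLinearMap (adjoint)

/-! The proof has two layers: linear well-posedness of the state equation, and a convex quadratic
argument in Hilbert space.

Well-posedness. Let `V` = H¹(K), `H` = L²(K), let `ι : V → H` be the embedding, `D` the weak
gradient and J = ιι* = (1 + D*D)⁻¹. For u = Jw with w in H¹(0,S;H), u' + D*D u + κu equals Jw' + (1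
- J)w + κJw, which involves bounded operators only. Such u satisfy an energy estimate in which the
L² norm of the source carries the factor 1/(2κ) (`strongSol_energy`), and their data are dense
(`denseRange_strongData`); so the solution map extends to all data. Multiplication by e^{κs} removes
κ. The terms A v + B·∇v - (N/2)v form a bounded operator L²(0,S;V) → L²(0,S;H), and for large κ a
Neumann series absorbs them (`exists_solutionOperator`). This gives `exists_stateOperator`: the
state depends on the initial value and the source through one bounded linear operator. Hence each
L_i is bounded and the final state is z + ∑ L_j h_j, where z is the state without followers.

Nash part. The weight |D_{y,s}| is at least δ = e^{-(N+2)S/2}, while the coupling terms of 𝔏 are at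
most ε(∑‖L_j‖‖h_j‖)²; for small ε they cost at most half of δ‖h‖² (`nashOp_coercive`), and
Lax-Milgram inverts 𝔏. Each J_i is an exactly quadratic, convex function of h_i, so equilibria are
the common zeros of the partial gradients (`isMin_reducedCost_iff`). If χ_i denotes restriction to
O_i', then L_i = L_i χ_i, so these gradients see h only through the χ_i h_i and vanish exactly when
𝔏(χh) = ξ (`nashOp_restrictRegion_eq_iff`). Since 𝔏 is injective and its solution of 𝔏h = ξ is
supported in the regions, h' is an equilibrium exactly when χh' = h. -/

/-! ### Calculus on the time interval -/

section Time

variable {G G' : Type*} [NormedAddCommGroup G] [InnerProductSpace ℝ G] [CompleteSpace G]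
  [NormedAddCommGroup G'] [InnerProductSpace ℝ G'] [CompleteSpace G']

/-- Integration by parts for the primitives of two integrable Hilbert space valued functions. -/
theorem integral_inner_primitive_add {ν : Measure ℝ} [SFinite ν] [NullSingletonClass ν] {a b : ℝ → G}
    (ha : Integrable a ν) (hb : Integrable b ν) :
    ∫ t, ⟪a t, ∫ r in Iic t, b r ∂ν⟫_ℝ ∂ν + ∫ t, ⟪∫ r in Iic t, a r ∂ν, b t⟫_ℝ ∂ν
      = ⟪∫ t, a t ∂ν, ∫ t, b t ∂ν⟫_ℝ := by
  have hab : Integrable (fun z : ℝ × ℝ => ⟪a z.1, b z.2⟫_ℝ) (ν.prod ν) := by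
    refine (ha.norm.mul_prod hb.norm).mono
      (ha.aestronglyMeasurable.comp_fst.inner hb.aestronglyMeasurable.comp_snd) ?_
    filter_upwards with z
    simpa using abs_real_inner_le_norm (a z.1) (b z.2)
  have hle : MeasurableSet {z : ℝ × ℝ | z.2 ≤ z.1} := measurableSet_le measurable_snd measurable_fst
  have hlt : MeasurableSet {z : ℝ × ℝ | z.1 < z.2} := measurableSet_lt measurable_fst measurable_snd
  have h1 : ∫ t, ⟪a t, ∫ r in Iic t, b r ∂ν⟫_ℝ ∂ν
      = ∫ z in {z : ℝ × ℝ | z.2 ≤ z.1}, ⟪a z.1, b z.2⟫_ℝ ∂(ν.prod ν) := by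
    rw [← integral_indicator hle, integral_prod _ (hab.indicator hle)]
    refine integral_congr_ae (.of_forall fun t => ?_)
    simp only
    rw [← integral_inner hb.integrableOn, ← integral_indicator measurableSet_Iic]
    rfl
  have h2 : ∫ t, ⟪∫ r in Iic t, a r ∂ν, b t⟫_ℝ ∂ν
      = ∫ z in {z : ℝ × ℝ | z.1 < z.2}, ⟪a z.1, b z.2⟫_ℝ ∂(ν.prod ν) := by
    rw [← integral_indicator hlt, integral_prod_symm _ (hab.indicator hlt)]
    refine integral_congr_ae (.of_forall fun t => ?_)
    simp only
    -- The two triangles must be disjoint. Since ν has no atoms, the diagonal can be dropped from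
    -- this one.
    rw [real_inner_comm, ← integral_inner ha.integrableOn, integral_Iic_eq_integral_Iio,
      ← integral_indicator measurableSet_Iio]
    refine integral_congr_ae (.of_forall fun r => ?_)
    simp [indicator, real_inner_comm]
  have hc : {z : ℝ × ℝ | z.1 < z.2} = {z : ℝ × ℝ | z.2 ≤ z.1}ᶜ := by ext; simp
  rw [h1, h2, hc, integral_add_compl hle hab, integral_prod _ hab]
  simp only [integral_inner hb]
  simp only [real_inner_comm (∫ t, b t ∂ν)]
  rw [integral_inner ha, real_inner_comm]

variable {S : ℝ}

instance isFiniteMeasure_timeMeas (S : ℝ) : IsFiniteMeasure (timeMeas S) :=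
  ⟨by simp [timeMeas]⟩

theorem integrable_Lp_two {μ : Measure ℝ} [IsFiniteMeasure μ] (f : Lp G 2 μ) : Integrable f μ :=
  (Lp.memLp f).integrable (by norm_num)

theorem continuous_setIntegral_Iic {μ : Measure ℝ} [NullSingletonClass μ] {f : ℝ → G}
    (hf : Integrable f μ) : Continuous fun s => ∫ t in Iic s, f t ∂μ := by
  have h : (fun s => ∫ t in Iic s, f t ∂μ)
      = fun s => (∫ t in (0 : ℝ)..s, f t ∂μ) + ∫ t in Iic 0, f t ∂μ := by
    ext s
    rw [← intervalIntegral.integral_Iic_sub_Iic hf.integrableOn hf.integrableOn]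
    abel
  rw [h]
  exact (intervalIntegral.continuous_primitive (fun a b => hf.intervalIntegrable) 0).add
    continuous_const

theorem norm_setIntegral_le_Lp_two {μ : Measure ℝ} [IsFiniteMeasure μ] (f : Lp G 2 μ) {s : Set ℝ}
    (hs : MeasurableSet s) :
    ‖∫ t in s, f t ∂μ‖ ≤ √(μ.real univ) * ‖f‖ := by
  have hμs : μ s ≠ ⊤ := measure_ne_top _ _
  set c := ∫ t in s, f t ∂μ with hc
  -- Pairing f with the indicator of s times the vector c gives ‖c‖²; Cauchy-Schwarz then bounds
  -- ‖c‖.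
  have h := L2.inner_indicatorConstLp_eq_inner_setIntegral ℝ hs hμs c f
  have h2 := (real_inner_le_norm (indicatorConstLp 2 hs hμs c) f)
  rw [h, ← hc, real_inner_self_eq_norm_sq, norm_indicatorConstLp (by simp) (by simp)] at h2
  have h3 : μ.real s ^ (1 / (2 : ℝ≥0∞).toReal) ≤ √(μ.real univ) := by
    rw [ENNReal.toReal_ofNat, ← Real.sqrt_eq_rpow]
    exact Real.sqrt_le_sqrt (measureReal_mono (subset_univ s))
  rcases (norm_nonneg c).eq_or_lt with h0 | h0
  · rw [← h0]; positivity
  · have h4 : ‖c‖ * ‖c‖ ≤ ‖c‖ * (√(μ.real univ) * ‖f‖) := by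
      calc ‖c‖ * ‖c‖ = ‖c‖ ^ 2 := by ring
        _ ≤ _ := h2
        _ ≤ ‖c‖ * √(μ.real univ) * ‖f‖ := by gcongr
        _ = _ := by ring
    exact le_of_mul_le_mul_left h4 h0

/-- The primitive `s ↦ ∫_{(0,s)} f` of `f ∈ L²(0,S;G)`, as a bounded continuous function on `ℝ`
(constant to the left of `0` and to the right of `S`). -/
def prim : Lp G 2 (timeMeas S) →L[ℝ] (ℝ →ᵇ G) :=
  LinearMap.mkContinuous
    { toFun f := BoundedContinuousFunction.ofNormedAddCommGroup
        (fun s => ∫ t in Iic s, f t ∂(timeMeas S)) (continuous_setIntegral_Iic (integrable_Lp_two f))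
        _ fun _ => norm_setIntegral_le_Lp_two f measurableSet_Iic
      map_add' f g := by
        ext s
        change ∫ t in Iic s, (f + g : Lp G 2 _) t ∂_ = _
        rw [integral_congr_ae (ae_restrict_of_ae (Lp.coeFn_add f g))]
        exact integral_add (integrable_Lp_two f).integrableOn (integrable_Lp_two g).integrableOn
      map_smul' c f := by
        ext s
        change ∫ t in Iic s, (c • f : Lp G 2 _) t ∂_ = _
        rw [integral_congr_ae (ae_restrict_of_ae (Lp.coeFn_smul c f))]
        exact integral_smul c _ }
    (√((timeMeas S).real univ)) fun f => by
      refine (BoundedContinuousFunction.norm_le (by positivity)).2 fun s => ?_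
      exact norm_setIntegral_le_Lp_two f measurableSet_Iic

theorem prim_apply (f : Lp G 2 (timeMeas S)) (s : ℝ) :
    prim f s = ∫ t in Iic s, f t ∂(timeMeas S) := rfl

theorem prim_compLpL (T : G →L[ℝ] G') (f : Lp G 2 (timeMeas S)) (s : ℝ) :
    prim (T.compLpL 2 _ f) s = T (prim f s) := by
  rw [prim_apply, prim_apply, ← T.integral_comp_comm (integrable_Lp_two f).integrableOn]
  exact integral_congr_ae (ae_restrict_of_ae (T.coeFn_compLpL f))

theorem inner_prim (f : Lp G 2 (timeMeas S)) (s : ℝ) (c : G) :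
    ⟪prim f s, c⟫_ℝ = ∫ t in Iic s, ⟪f t, c⟫_ℝ ∂(timeMeas S) := by
  rw [prim_apply, real_inner_comm, ← integral_inner (integrable_Lp_two f).integrableOn]
  simp only [real_inner_comm]

/-- Connects `prim` with the interval integrals of `IsWeakSolution`. The open and half-open
intervals differ by the null set {S} when s = S. -/
theorem setIntegral_Iic_timeMeas {E : Type*} [NormedAddCommGroup E] [NormedSpace ℝ E]
    (f : ℝ → E) {s : ℝ} (hs : s ∈ Icc 0 S) :
    ∫ t in Iic s, f t ∂(timeMeas S) = ∫ t in (0 : ℝ)..s, f t := by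
  rw [intervalIntegral.integral_of_le hs.1, timeMeas, Measure.restrict_restrict measurableSet_Iic]
  refine setIntegral_congr_set ?_
  rcases hs.2.eq_or_lt with rfl | h
  · rw [inter_eq_right.2 fun x hx => hx.2.le]
    exact Ioo_ae_eq_Ioc
  · have : Iic s ∩ Ioo 0 S = Ioc 0 s := by
      ext x; simp only [mem_inter_iff, mem_Iic, mem_Ioo, mem_Ioc]; grind
    rw [this]
    exact .rfl

/-- The inclusion of bounded continuous functions in `L²(0,S;G)`. -/
abbrev ofCont : (ℝ →ᵇ G) →L[ℝ] Lp G 2 (timeMeas S) :=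
  BoundedContinuousFunction.toLp 2 (timeMeas S) ℝ

theorem coeFn_ofCont (v : ℝ →ᵇ G) : (ofCont v : Lp G 2 (timeMeas S)) =ᵐ[timeMeas S] v :=
  BoundedContinuousFunction.coeFn_toLp _ _ _ _

theorem setIntegral_inner_prim (a b : Lp G 2 (timeMeas S)) (s : ℝ) :
    ∫ t in Iic s, ⟪a t, prim b t⟫_ℝ ∂(timeMeas S) + ∫ t in Iic s, ⟪prim a t, b t⟫_ℝ ∂(timeMeas S)
      = ⟪prim a s, prim b s⟫_ℝ := by
  rw [prim_apply, prim_apply, ← integral_inner_primitive_add (integrable_Lp_two a).integrableOn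
    (integrable_Lp_two b).integrableOn]
  have key (f : ℝ → G) (t : ℝ) (ht : t ∈ Iic s) :
      ∫ r in Iic t, f r ∂(timeMeas S).restrict (Iic s) = ∫ r in Iic t, f r ∂(timeMeas S) := by
    rw [Measure.restrict_restrict measurableSet_Iic, inter_eq_left.2 (Iic_subset_Iic.2 ht)]
  congr 1 <;>
  · refine setIntegral_congr_fun measurableSet_Iic fun t ht => ?_
    simp only [key _ t ht, prim_apply]

theorem restrict_Iic_timeMeas (S : ℝ) : (timeMeas S).restrict (Iic S) = timeMeas S := by
  rw [timeMeas, Measure.restrict_restrict measurableSet_Iic, inter_eq_right.2 fun x hx => hx.2.le]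

/-- For a symmetric operator `Q`, `t ↦ ½ ⟪Q h(t), h(t)⟫` is a primitive of `⟪Q h, h'⟫`. -/
theorem setIntegral_inner_symmetric_prim (Q : G →L[ℝ] G) (hQ : ∀ a b, ⟪Q a, b⟫_ℝ = ⟪a, Q b⟫_ℝ)
    (h : Lp G 2 (timeMeas S)) (s : ℝ) :
    ∫ t in Iic s, ⟪Q (prim h t), h t⟫_ℝ ∂(timeMeas S) = 1 / 2 * ⟪Q (prim h s), prim h s⟫_ℝ := by
  have key := setIntegral_inner_prim h (Q.compLpL 2 _ h) s
  have h1 : ∫ t in Iic s, ⟪h t, prim (Q.compLpL 2 _ h) t⟫_ℝ ∂(timeMeas S)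
      = ∫ t in Iic s, ⟪Q (prim h t), h t⟫_ℝ ∂(timeMeas S) := by
    simp only [prim_compLpL, real_inner_comm]
  have h2 : ∫ t in Iic s, ⟪prim h t, Q.compLpL 2 _ h t⟫_ℝ ∂(timeMeas S)
      = ∫ t in Iic s, ⟪Q (prim h t), h t⟫_ℝ ∂(timeMeas S) := by
    refine integral_congr_ae (ae_restrict_of_ae ?_)
    filter_upwards [Q.coeFn_compLpL (p := 2) (μ := timeMeas S) h] with t ht
    rw [ht, hQ]
  rw [h1, h2, prim_compLpL, ← hQ] at key
  linarith

/-- The energy identity for `t ↦ c + ∫₀ᵗ g`. -/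
theorem setIntegral_inner_const_add_prim (g : Lp G 2 (timeMeas S)) (c : G) (s : ℝ) :
    ∫ t in Iic s, ⟪g t, c + prim g t⟫_ℝ ∂(timeMeas S)
      = 1 / 2 * (‖c + prim g s‖ ^ 2 - ‖c‖ ^ 2) := by
  have h1 := setIntegral_inner_symmetric_prim (ContinuousLinearMap.id ℝ G) (fun _ _ => rfl) g s
  simp only [ContinuousLinearMap.id_apply, real_inner_self_eq_norm_sq] at h1
  have h2 := inner_prim g s c
  have h3 : Integrable (fun t => ⟪g t, c⟫_ℝ) (timeMeas S) :=
    (integrable_Lp_two g).inner_const c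
  have h4 : Integrable (fun t => ⟪prim g t, g t⟫_ℝ) (timeMeas S) := by
    refine (L2.integrable_inner (𝕜 := ℝ) (ofCont (prim g)) g).congr ?_
    filter_upwards [coeFn_ofCont (S := S) (prim g)] with t ht
    rw [ht]
  simp only [inner_add_right, real_inner_comm (g _) (prim g _)] at *
  rw [integral_add h3.integrableOn h4.integrableOn, h1, ← h2, norm_add_sq_real,
    real_inner_comm c]
  ring

theorem coeFn_mulOp {X F : Type*} [MeasurableSpace X] {μ : Measure X} [NormedAddCommGroup F]
    [NormedSpace ℝ F] (m : Lp ℝ ∞ μ) (f : Lp F 2 μ) :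
    mulOp m f =ᵐ[μ] fun x => m x • f x :=
  ContinuousLinearMap.coeFn_holder _ m f

end Time

/-! ### The abstract autonomous evolution equation -/

section Autonomous

variable {H V E : Type*} [NormedAddCommGroup H] [InnerProductSpace ℝ H] [CompleteSpace H]
  [NormedAddCommGroup V] [InnerProductSpace ℝ V] [CompleteSpace V]
  [NormedAddCommGroup E] [InnerProductSpace ℝ E] [CompleteSpace E]
  {ι : V →L[ℝ] H} {D : V →L[ℝ] E} {S : ℝ}

/-- `V` is the form domain of the operator `D* D` on `H`: the embedding `ι : V → H` is injective
with dense range, and `V` carries the graph norm of `D`. -/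
structure IsFormDomain (ι : V →L[ℝ] H) (D : V →L[ℝ] E) : Prop where
  inner_eq : ∀ u v, ⟪u, v⟫_ℝ = ⟪ι u, ι v⟫_ℝ + ⟪D u, D v⟫_ℝ
  injective : Function.Injective ι
  denseRange : DenseRange ι

/-- The resolvent `(1 + D* D)⁻¹ = ι ι*` on `H`. -/
def resolvent (ι : V →L[ℝ] H) : H →L[ℝ] H := ι ∘L adjoint ι

theorem resolvent_apply (w : H) : resolvent ι w = ι (adjoint ι w) := rfl

theorem resolvent_symm (a b : H) : ⟪resolvent ι a, b⟫_ℝ = ⟪a, resolvent ι b⟫_ℝ := by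
  rw [resolvent_apply, resolvent_apply, ← ContinuousLinearMap.adjoint_inner_right,
    ContinuousLinearMap.adjoint_inner_left]

theorem inner_resolvent_self (w : H) : ⟪resolvent ι w, w⟫_ℝ = ‖adjoint ι w‖ ^ 2 := by
  rw [resolvent_apply, ← ContinuousLinearMap.adjoint_inner_right, real_inner_self_eq_norm_sq]

namespace IsFormDomain

variable (hD : IsFormDomain ι D)
include hD

theorem norm_sq_eq (u : V) : ‖u‖ ^ 2 = ‖ι u‖ ^ 2 + ‖D u‖ ^ 2 := by
  simpa only [real_inner_self_eq_norm_sq] using hD.inner_eq u u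

theorem norm_ι_le (u : V) : ‖ι u‖ ≤ ‖u‖ := by
  have := hD.norm_sq_eq u
  refine le_of_sq_le_sq ?_ (norm_nonneg _)
  nlinarith [sq_nonneg ‖D u‖]

theorem norm_adjoint_le (w : H) : ‖adjoint ι w‖ ≤ ‖w‖ := by
  have h1 : ‖adjoint ι w‖ ^ 2 ≤ ‖w‖ * ‖adjoint ι w‖ := by
    rw [← real_inner_self_eq_norm_sq, ContinuousLinearMap.adjoint_inner_left]
    exact (real_inner_le_norm _ _).trans (by gcongr; exact hD.norm_ι_le _)
  rcases (norm_nonneg (adjoint ι w)).eq_or_lt with h0 | h0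
  · rw [← h0]; positivity
  · exact le_of_mul_le_mul_right (by rwa [← sq]) h0

/-- The weak form of D*D J = 1 - J. Through it the unbounded operator disappears from the equation
whenever the unknown has the form Jw. -/
theorem inner_D_adjoint (w : H) (ψ : V) :
    ⟪D (adjoint ι w), D ψ⟫_ℝ = ⟪w, ι ψ⟫_ℝ - ⟪resolvent ι w, ι ψ⟫_ℝ := by
  have := hD.inner_eq (adjoint ι w) ψ
  rw [ContinuousLinearMap.adjoint_inner_left] at this
  rw [resolvent_apply]
  linarith

/-- The kernel of ι* is the orthogonal complement of the range of ι, which is dense. -/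
theorem eq_zero_of_adjoint_eq_zero {w : H} (h : adjoint ι w = 0) : w = 0 := by
  refine hD.denseRange.eq_zero_of_inner_left ℝ fun v => ?_
  rw [← ContinuousLinearMap.adjoint_inner_left, h, inner_zero_left]

theorem inner_resolvent_le (w : H) : ⟪resolvent ι w, w⟫_ℝ ≤ ⟪w, w⟫_ℝ := by
  rw [inner_resolvent_self, real_inner_self_eq_norm_sq]
  have := hD.norm_adjoint_le w
  gcongr

end IsFormDomain

/-- `v ∈ C([0,S];H)`, with `v = ι p` and `p ∈ L²(0,S;V)`, is the weak solution of
`v' + D* D v = f`, `v(0) = v₀`. -/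
def IsMildSolution (ι : V →L[ℝ] H) (D : V →L[ℝ] E) (v₀ : H) (f : Lp H 2 (timeMeas S))
    (v : ℝ →ᵇ H) (p : Lp V 2 (timeMeas S)) : Prop :=
  ofCont v = ι.compLpL 2 (timeMeas S) p ∧ ∀ (ψ : V) (s : ℝ),
    ⟪v s, ι ψ⟫_ℝ + ⟪prim (D.compLpL 2 _ p) s, D ψ⟫_ℝ = ⟪v₀, ι ψ⟫_ℝ + ⟪prim f s, ι ψ⟫_ℝ

theorem IsMildSolution.sub {v₀ v₀' : H} {f f' : Lp H 2 (timeMeas S)} {v v' : ℝ →ᵇ H}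
    {p p' : Lp V 2 (timeMeas S)} (h : IsMildSolution ι D v₀ f v p)
    (h' : IsMildSolution ι D v₀' f' v' p') :
    IsMildSolution ι D (v₀ - v₀') (f - f') (v - v') (p - p') := by
  refine ⟨by rw [map_sub, map_sub, h.1, h'.1], fun ψ s => ?_⟩
  simp only [map_sub, BoundedContinuousFunction.sub_apply, inner_sub_left]
  linarith [h.2 ψ s, h'.2 ψ s]

/-- Testing with ψ = ι*ξ gives Jv + (1 - J)Z = 0, where Z = ∫₀ˢ v. Pairing with v = Z' and
integrating in time gives ∫‖ι*v‖² + ½⟪(1 - J)Z(S), Z(S)⟫ = 0. Both terms are nonnegative because J ≤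
1, so ι*v = 0 almost everywhere. No time derivative of v is needed. -/
theorem IsMildSolution.eq_zero (hD : IsFormDomain ι D) {v : ℝ →ᵇ H} {p : Lp V 2 (timeMeas S)}
    (h : IsMildSolution ι D 0 0 v p) : v = 0 ∧ p = 0 := by
  obtain ⟨h1, h2⟩ := h
  set z : Lp H 2 (timeMeas S) := ofCont v with hz
  have hZ (s : ℝ) : resolvent ι (v s) + (prim z s - resolvent ι (prim z s)) = 0 := by
    refine ext_inner_right ℝ fun ξ => ?_
    have := h2 (adjoint ι ξ) s
    rw [prim_compLpL, real_inner_comm, real_inner_comm _ (D _), hD.inner_D_adjoint,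
      ← prim_compLpL ι, ← h1] at this
    rw [inner_add_left, inner_sub_left, inner_zero_left, resolvent_symm, resolvent_symm,
      real_inner_comm (resolvent ι ξ), real_inner_comm (resolvent ι ξ), real_inner_comm ξ]
    simp only [inner_zero_left, map_zero, BoundedContinuousFunction.coe_zero, Pi.zero_apply] at this
    rw [← resolvent_apply] at this
    linarith
  have hsymm (a b : H) : ⟪(ContinuousLinearMap.id ℝ H - resolvent ι) a, b⟫_ℝ
      = ⟪a, (ContinuousLinearMap.id ℝ H - resolvent ι) b⟫_ℝ := by
    simp [inner_sub_left, inner_sub_right, resolvent_symm]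
  have key := setIntegral_inner_symmetric_prim _ hsymm z S
  rw [restrict_Iic_timeMeas] at key
  have h3 : ∫ t, ⟪(ContinuousLinearMap.id ℝ H - resolvent ι) (prim z t), z t⟫_ℝ ∂(timeMeas S)
      = - ∫ t, ‖adjoint ι (v t)‖ ^ 2 ∂(timeMeas S) := by
    rw [← integral_neg]
    refine integral_congr_ae ?_
    filter_upwards [coeFn_ofCont (S := S) v] with t ht
    have := eq_neg_of_add_eq_zero_right (hZ t)
    simp only [sub_apply, ContinuousLinearMap.id_apply, hz, ht] at this ⊢
    rw [this, inner_neg_left, inner_resolvent_self]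
  have h4 : 0 ≤ ⟪(ContinuousLinearMap.id ℝ H - resolvent ι) (prim z S), prim z S⟫_ℝ := by
    simpa [inner_sub_left] using hD.inner_resolvent_le (prim z S)
  have hint : Integrable (fun t => ‖adjoint ι (v t)‖ ^ 2) (timeMeas S) := by
    refine ((Lp.memLp ((adjoint ι).compLpL 2 _ z)).integrable_norm_pow (by norm_num)).congr ?_
    filter_upwards [coeFn_ofCont (S := S) v, (adjoint ι).coeFn_compLpL (p := 2) z] with t ht ht'
    rw [ht', hz, ht]
  have h5 : ∫ t, ‖adjoint ι (v t)‖ ^ 2 ∂(timeMeas S) = 0 :=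
    le_antisymm (by linarith) (integral_nonneg fun _ => by positivity)
  have h6 := (integral_eq_zero_iff_of_nonneg (fun _ => by positivity) hint).1 h5
  have hz0 : z = 0 := by
    refine (Lp.eq_zero_iff_ae_eq_zero).2 ?_
    filter_upwards [h6, coeFn_ofCont (S := S) v] with t ht ht'
    rw [hz, ht']
    exact hD.eq_zero_of_adjoint_eq_zero (by simpa using ht)
  constructor
  -- With Z = 0 the resolvent identity reads Jv(s) = 0 at every s, not only almost every s.
  · ext s
    have := hZ s
    rw [hz0] at this
    simp only [map_zero, BoundedContinuousFunction.coe_zero, Pi.zero_apply, sub_zero,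
      add_zero] at this
    refine hD.eq_zero_of_adjoint_eq_zero ?_
    have h7 := inner_resolvent_self (ι := ι) (v s)
    rw [this] at h7
    simpa using h7.symm
  · refine (Lp.eq_zero_iff_ae_eq_zero).2 ?_
    have h8 : ι.compLpL 2 _ p = 0 := by rw [← h1, hz0]
    filter_upwards [(Lp.eq_zero_iff_ae_eq_zero).1 h8, ι.coeFn_compLpL (p := 2) p] with t ht ht'
    exact hD.injective (by rw [← ht', ht]; simp)

variable (S) in
/-- The trajectory `w(s) = w₀ + ∫₀ˢ w'` with data `(w₀, w')`. -/
def traj : WithLp 2 (H × Lp H 2 (timeMeas S)) →ₗ[ℝ] (ℝ →ᵇ H) where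
  toFun x := BoundedContinuousFunction.const ℝ x.fst + prim x.snd
  map_add' x y := by
    ext s
    simp only [WithLp.add_fst, WithLp.add_snd, map_add, BoundedContinuousFunction.add_apply,
      BoundedContinuousFunction.const_apply]
    abel
  map_smul' c x := by
    ext s
    simp

theorem traj_apply (x : WithLp 2 (H × Lp H 2 (timeMeas S))) (s : ℝ) :
    traj S x s = x.fst + prim x.snd s := rfl

/-- The zeroth order operator `1 - J + κ J`, where `J` is the resolvent. -/
def yosida (ι : V →L[ℝ] H) (κ : ℝ) : H →L[ℝ] H :=
  ContinuousLinearMap.id ℝ H - resolvent ι + κ • resolvent ι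

/-- The data `(u(0), u' + D* D u + κ u)` of the strong solution `u = J w`. -/
def strongData (ι : V →L[ℝ] H) (S κ : ℝ) :
    WithLp 2 (H × Lp H 2 (timeMeas S)) →ₗ[ℝ] WithLp 2 (H × Lp H 2 (timeMeas S)) where
  toFun x := WithLp.toLp 2 (resolvent ι x.fst,
    (resolvent ι).compLpL 2 _ x.snd + (yosida ι κ).compLpL 2 _ (ofCont (traj S x)))
  map_add' x y := by
    simp only [WithLp.add_fst, WithLp.add_snd, map_add, ← WithLp.toLp_add, Prod.mk_add_mk]
    congr 2
    abel
  map_smul' c x := by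
    simp [← WithLp.toLp_smul]

/-- The strong solution `u = J w`. -/
def strongSol (ι : V →L[ℝ] H) (S : ℝ) :
    WithLp 2 (H × Lp H 2 (timeMeas S)) →ₗ[ℝ] (ℝ →ᵇ H) :=
  ((resolvent ι).compLeftContinuousBounded ℝ : (ℝ →ᵇ H) →ₗ[ℝ] (ℝ →ᵇ H)) ∘ₗ traj S

/-- The strong solution `u = J w`, as an element of `L²(0,S;V)`. -/
def strongSolV (ι : V →L[ℝ] H) (S : ℝ) :
    WithLp 2 (H × Lp H 2 (timeMeas S)) →ₗ[ℝ] Lp V 2 (timeMeas S) :=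
  ((adjoint ι).compLpL 2 _ ∘L ofCont : (ℝ →ᵇ H) →L[ℝ] Lp V 2 (timeMeas S)).toLinearMap ∘ₗ traj S

theorem strongData_fst (κ : ℝ) (x : WithLp 2 (H × Lp H 2 (timeMeas S))) :
    (strongData ι S κ x).fst = resolvent ι x.fst := rfl

theorem strongData_snd (κ : ℝ) (x : WithLp 2 (H × Lp H 2 (timeMeas S))) :
    (strongData ι S κ x).snd
      = (resolvent ι).compLpL 2 _ x.snd + (yosida ι κ).compLpL 2 _ (ofCont (traj S x)) := rfl

theorem coeFn_strongData_snd (κ : ℝ) (x : WithLp 2 (H × Lp H 2 (timeMeas S))) :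
    (strongData ι S κ x).snd =ᵐ[timeMeas S]
      fun t => resolvent ι (x.snd t) + yosida ι κ (traj S x t) := by
  rw [strongData_snd]
  filter_upwards [Lp.coeFn_add ((resolvent ι).compLpL 2 _ x.snd)
      ((yosida ι κ).compLpL 2 _ (ofCont (traj S x))),
    (resolvent ι).coeFn_compLpL (p := 2) x.snd,
    (yosida ι κ).coeFn_compLpL (p := 2) (ofCont (traj S x) : Lp H 2 (timeMeas S)),
    coeFn_ofCont (S := S) (traj S x)] with t h1 h2 h3 h4
  rw [h1, Pi.add_apply, h2, h3, h4]

theorem strongSol_apply (x : WithLp 2 (H × Lp H 2 (timeMeas S))) (s : ℝ) :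
    strongSol ι S x s = resolvent ι (traj S x s) := rfl

theorem coeFn_strongSolV (x : WithLp 2 (H × Lp H 2 (timeMeas S))) :
    strongSolV ι S x =ᵐ[timeMeas S] fun t => adjoint ι (traj S x t) := by
  filter_upwards [(adjoint ι).coeFn_compLpL (p := 2) (ofCont (traj S x) : Lp H 2 (timeMeas S)),
    coeFn_ofCont (S := S) (traj S x)] with t h1 h2
  exact h1.trans (by rw [h2])

theorem yosida_symm (κ : ℝ) (a b : H) : ⟪yosida ι κ a, b⟫_ℝ = ⟪a, yosida ι κ b⟫_ℝ := by
  simp [yosida, inner_sub_left, inner_sub_right, inner_add_left, inner_add_right,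
    inner_smul_left, inner_smul_right, resolvent_symm]

theorem inner_yosida_self_nonneg (hD : IsFormDomain ι D) {κ : ℝ} (hκ : 0 ≤ κ) (a : H) :
    0 ≤ ⟪yosida ι κ a, a⟫_ℝ := by
  have h1 := hD.inner_resolvent_le a
  have h2 : 0 ≤ κ * ⟪resolvent ι a, a⟫_ℝ := by rw [inner_resolvent_self]; positivity
  simp only [yosida, add_apply, sub_apply, ContinuousLinearMap.id_apply, smul_apply, inner_add_left,
    inner_sub_left, inner_smul_left, conj_trivial]
  linarith

/-- Let (y₁, y₂) be orthogonal to the range, and let Q = 1 - J + κJ, which is symmetric and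
nonnegative. The trajectory with w(0) = 0 and w' = y₂ gives ∫‖ι*y₂‖² + ½⟪Qw(S), w(S)⟫ = 0, so y₂ =
0. The constant trajectory y₁ then gives ‖ι*y₁‖² = 0. -/
theorem denseRange_strongData (hD : IsFormDomain ι D) {κ : ℝ} (hκ : 0 ≤ κ) :
    DenseRange (strongData ι S κ) := by
  have : (LinearMap.range (strongData ι S κ)).topologicalClosure = ⊤ := by
    rw [Submodule.topologicalClosure_eq_top_iff, Submodule.eq_bot_iff]
    intro y hy
    have hy' (x : WithLp 2 (H × Lp H 2 (timeMeas S))) : ⟪strongData ι S κ x, y⟫_ℝ = 0 :=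
      hy _ ⟨x, rfl⟩
    have h2 : y.snd = 0 := by
      have h := hy' (WithLp.toLp 2 (0, y.snd))
      have htraj (t : ℝ) : traj S (WithLp.toLp 2 ((0 : H), y.snd)) t = prim y.snd t := by
        simp [traj_apply]
      rw [WithLp.prod_inner_apply] at h
      change ⟪(strongData ι S κ _).fst, y.fst⟫_ℝ + ⟪(strongData ι S κ _).snd, y.snd⟫_ℝ = 0 at h
      rw [strongData_fst, L2.inner_def] at h
      simp only [WithLp.toLp_fst, map_zero, inner_zero_left, zero_add] at h
      have hR : Integrable (fun t => ‖adjoint ι (y.snd t)‖ ^ 2) (timeMeas S) := by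
        refine ((Lp.memLp ((adjoint ι).compLpL 2 _ y.snd)).integrable_norm_pow
          (by norm_num)).congr ?_
        filter_upwards [(adjoint ι).coeFn_compLpL (p := 2) y.snd] with t ht
        rw [ht]
      have hQ : Integrable (fun t => ⟪yosida ι κ (prim y.snd t), y.snd t⟫_ℝ) (timeMeas S) := by
        refine (L2.integrable_inner (𝕜 := ℝ)
          ((yosida ι κ).compLpL 2 _ (ofCont (prim y.snd))) y.snd).congr ?_
        filter_upwards [(yosida ι κ).coeFn_compLpL (p := 2)
          (ofCont (prim y.snd) : Lp H 2 (timeMeas S)), coeFn_ofCont (S := S) (prim y.snd)]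
          with t ht ht'
        rw [ht, ht']
      have h3 : ∫ t, ‖adjoint ι (y.snd t)‖ ^ 2 ∂(timeMeas S)
          + ∫ t, ⟪yosida ι κ (prim y.snd t), y.snd t⟫_ℝ ∂(timeMeas S) = 0 := by
        rw [← integral_add hR hQ, ← h]
        refine integral_congr_ae ?_
        filter_upwards [coeFn_strongData_snd (ι := ι) κ
          (WithLp.toLp 2 ((0 : H), y.snd))] with t ht
        rw [ht, htraj, inner_add_left, ← inner_resolvent_self]
        rfl
      have h4 := setIntegral_inner_symmetric_prim _ (yosida_symm (ι := ι) κ) y.snd S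
      rw [restrict_Iic_timeMeas] at h4
      have h5 := inner_yosida_self_nonneg hD hκ (prim y.snd S)
      have h6 : ∫ t, ‖adjoint ι (y.snd t)‖ ^ 2 ∂(timeMeas S) = 0 :=
        le_antisymm (by linarith) (integral_nonneg fun _ => by positivity)
      refine (Lp.eq_zero_iff_ae_eq_zero).2 ?_
      filter_upwards [(integral_eq_zero_iff_of_nonneg (fun _ => by positivity) hR).1 h6] with t ht
      exact hD.eq_zero_of_adjoint_eq_zero (by simpa using ht)
    have h1 : y.fst = 0 := by
      have h := hy' (WithLp.toLp 2 (y.fst, 0))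
      rw [WithLp.prod_inner_apply] at h
      change ⟪(strongData ι S κ _).fst, y.fst⟫_ℝ + ⟪(strongData ι S κ _).snd, y.snd⟫_ℝ = 0 at h
      rw [h2, inner_zero_right, add_zero, strongData_fst, WithLp.toLp_fst,
        inner_resolvent_self] at h
      exact hD.eq_zero_of_adjoint_eq_zero (by simpa using h)
    exact WithLp.ofLp_injective 2 (Prod.ext h1 h2)
  intro y
  have h : y ∈ (LinearMap.range (strongData ι S κ)).topologicalClosure := this ▸ Submodule.mem_top
  rwa [← SetLike.mem_coe, Submodule.topologicalClosure_coe, LinearMap.coe_range] at h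

/-- The equation is paired with u = Jw. Since ⟪w, Jw⟫ = ‖ι*w‖² is the full V norm squared, (1 - J)w
contributes ‖u‖_V² - ‖u‖_H². Young's inequality spends κ/2 of the term κ‖u‖_H² on the source, and
the remaining κ/2 ≥ 1 restores the missing ‖u‖_H². -/
theorem strongSol_energy {κ : ℝ} (hκ : 2 ≤ κ)
    (x : WithLp 2 (H × Lp H 2 (timeMeas S))) (s : ℝ) :
    1 / 2 * ‖strongSol ι S x s‖ ^ 2 + ∫ t in Iic s, ‖strongSolV ι S x t‖ ^ 2 ∂(timeMeas S)
      ≤ 1 / 2 * ‖(strongData ι S κ x).fst‖ ^ 2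
        + 1 / (2 * κ) * ‖(strongData ι S κ x).snd‖ ^ 2 := by
  set f := (strongData ι S κ x).snd with hf
  have hκ0 : 0 < κ := by linarith
  have h1 := setIntegral_inner_const_add_prim ((resolvent ι).compLpL 2 _ x.snd)
    (resolvent ι x.fst) s
  have hu (t : ℝ) : resolvent ι x.fst + prim ((resolvent ι).compLpL 2 _ x.snd) t
      = strongSol ι S x t := by
    rw [prim_compLpL, strongSol_apply, traj_apply, map_add]
  simp only [hu] at h1
  have hi1 : Integrable (fun t => ⟪(resolvent ι).compLpL 2 (timeMeas S) x.snd t,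
      strongSol ι S x t⟫_ℝ) (timeMeas S) := by
    refine (L2.integrable_inner (𝕜 := ℝ) ((resolvent ι).compLpL 2 _ x.snd)
      (ofCont (strongSol ι S x))).congr ?_
    filter_upwards [coeFn_ofCont (S := S) (strongSol ι S x)] with t ht
    rw [ht]
  have hi2 : Integrable (fun t => ‖strongSolV ι S x t‖ ^ 2) (timeMeas S) :=
    (Lp.memLp _).integrable_norm_pow (by norm_num)
  have hi3 : Integrable (fun t => 1 / (2 * κ) * ‖f t‖ ^ 2) (timeMeas S) :=
    ((Lp.memLp f).integrable_norm_pow (by norm_num)).const_mul _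
  have h2 : ∫ t in Iic s, (⟪(resolvent ι).compLpL 2 (timeMeas S) x.snd t, strongSol ι S x t⟫_ℝ
      + ‖strongSolV ι S x t‖ ^ 2) ∂(timeMeas S)
      ≤ ∫ t in Iic s, 1 / (2 * κ) * ‖f t‖ ^ 2 ∂(timeMeas S) := by
    refine integral_mono_ae (hi1.add hi2).integrableOn hi3.integrableOn (ae_restrict_of_ae ?_)
    filter_upwards [coeFn_strongData_snd (ι := ι) κ x, coeFn_strongSolV (ι := ι) x,
      (resolvent ι).coeFn_compLpL (p := 2) x.snd] with t ht1 ht2 ht3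
    simp only [ht2, ht3, hf, ht1, strongSol_apply]
    set w := traj S x t
    set g := resolvent ι (x.snd t)
    set F := g + yosida ι κ w with hF
    have e1 : ⟪F, resolvent ι w⟫_ℝ = ⟪g, resolvent ι w⟫_ℝ
        + (⟪w, resolvent ι w⟫_ℝ - ‖resolvent ι w‖ ^ 2) + κ * ‖resolvent ι w‖ ^ 2 := by
      simp only [hF, yosida, add_apply, sub_apply, ContinuousLinearMap.id_apply, smul_apply,
        inner_add_left, inner_sub_left, inner_smul_left, conj_trivial, real_inner_self_eq_norm_sq]
      ring
    have e2 : ⟪w, resolvent ι w⟫_ℝ = ‖adjoint ι w‖ ^ 2 := by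
      rw [← inner_resolvent_self, real_inner_comm]
    have e3 : ⟪F, resolvent ι w⟫_ℝ
        ≤ 1 / (2 * κ) * ‖F‖ ^ 2 + κ / 2 * ‖resolvent ι w‖ ^ 2 := by
      refine (real_inner_le_norm _ _).trans ?_
      have : 0 ≤ 1 / (2 * κ) * (‖F‖ - κ * ‖resolvent ι w‖) ^ 2 := by positivity
      have e : 1 / (2 * κ) * (‖F‖ - κ * ‖resolvent ι w‖) ^ 2
        = 1 / (2 * κ) * ‖F‖ ^ 2 + κ / 2 * ‖resolvent ι w‖ ^ 2 - ‖F‖ * ‖resolvent ι w‖ := by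
        field_simp
        ring
      linarith
    have e4 : ‖resolvent ι w‖ ^ 2 ≤ κ / 2 * ‖resolvent ι w‖ ^ 2 :=
      le_mul_of_one_le_left (by positivity) (by linarith)
    linarith
  rw [integral_add hi1.integrableOn hi2.integrableOn, h1, integral_const_mul] at h2
  have h3 : ∫ t in Iic s, ‖f t‖ ^ 2 ∂(timeMeas S) ≤ ‖f‖ ^ 2 := by
    rw [← real_inner_self_eq_norm_sq f, L2.inner_def]
    simp only [real_inner_self_eq_norm_sq]
    exact setIntegral_le_integral ((Lp.memLp f).integrable_norm_pow (by norm_num))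
      (.of_forall fun _ => by positivity)
  have h4 : 1 / (2 * κ) * ∫ t in Iic s, ‖f t‖ ^ 2 ∂(timeMeas S) ≤ 1 / (2 * κ) * ‖f‖ ^ 2 := by
    gcongr
  rw [strongData_fst]
  linarith

theorem norm_sq_Lp_two {X F : Type*} [MeasurableSpace X] {μ : Measure X} [NormedAddCommGroup F]
    [InnerProductSpace ℝ F] (f : Lp F 2 μ) : ‖f‖ ^ 2 = ∫ x, ‖f x‖ ^ 2 ∂μ := by
  rw [← real_inner_self_eq_norm_sq f, L2.inner_def]
  simp only [real_inner_self_eq_norm_sq]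

/-- The factor 1/(2κ) is retained here because it makes the lower order terms a small perturbation.
The two cruder bounds that follow serve only to extend the solution maps by density. -/
theorem norm_strongSolV_le {κ : ℝ} (hκ : 2 ≤ κ)
    (x : WithLp 2 (H × Lp H 2 (timeMeas S))) :
    ‖strongSolV ι S x‖ ^ 2 ≤ 1 / 2 * ‖(strongData ι S κ x).fst‖ ^ 2
        + 1 / (2 * κ) * ‖(strongData ι S κ x).snd‖ ^ 2 := by
  have h := strongSol_energy (ι := ι) hκ x S
  rw [restrict_Iic_timeMeas, ← norm_sq_Lp_two] at h
  linarith [sq_nonneg ‖strongSol ι S x S‖]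

theorem norm_strongSolV_le' {κ : ℝ} (hκ : 2 ≤ κ)
    (x : WithLp 2 (H × Lp H 2 (timeMeas S))) :
    ‖strongSolV ι S x‖ ≤ 1 * ‖strongData ι S κ x‖ := by
  have h := norm_strongSolV_le (ι := ι) hκ x
  rw [one_mul]
  refine le_of_sq_le_sq ?_ (norm_nonneg _)
  rw [WithLp.prod_norm_sq_eq_of_L2]
  have : 1 / (2 * κ) ≤ 1 := by rw [div_le_one (by linarith)]; linarith
  nlinarith [sq_nonneg ‖(strongData ι S κ x).fst‖, sq_nonneg ‖(strongData ι S κ x).snd‖]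

theorem norm_strongSol_le {κ : ℝ} (hκ : 2 ≤ κ)
    (x : WithLp 2 (H × Lp H 2 (timeMeas S))) :
    ‖strongSol ι S x‖ ≤ 1 * ‖strongData ι S κ x‖ := by
  rw [one_mul]
  refine (BoundedContinuousFunction.norm_le (norm_nonneg _)).2 fun s => ?_
  have h := strongSol_energy (ι := ι) hκ x s
  have h0 : 0 ≤ ∫ t in Iic s, ‖strongSolV ι S x t‖ ^ 2 ∂(timeMeas S) :=
    integral_nonneg fun _ => by positivity
  refine le_of_sq_le_sq ?_ (norm_nonneg _)
  rw [WithLp.prod_norm_sq_eq_of_L2]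
  have : 1 / (2 * κ) ≤ 1 / 2 := by
    gcongr
    linarith
  nlinarith [sq_nonneg ‖(strongData ι S κ x).snd‖]

end Autonomous

/-! ### Exponential weights in time -/

section Weights

variable {G G' : Type*} [NormedAddCommGroup G] [InnerProductSpace ℝ G] [CompleteSpace G]
  [NormedAddCommGroup G'] [InnerProductSpace ℝ G'] [CompleteSpace G'] {S : ℝ}

theorem memLp_exp (S κ : ℝ) : MemLp (fun t => Real.exp (κ * t)) ∞ (timeMeas S) := by
  refine memLp_top_of_bound (by fun_prop) (Real.exp (|κ| * S)) ?_
  filter_upwards [ae_restrict_mem measurableSet_Ioo] with t ht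
  rw [Real.norm_eq_abs, Real.abs_exp, Real.exp_le_exp]
  calc κ * t ≤ |κ| * t := by gcongr; exacts [ht.1.le, le_abs_self κ]
    _ ≤ |κ| * S := by gcongr; exact ht.2.le

variable (S) in
/-- Multiplication by `t ↦ e^{κ t}` on `L²(0,S;G)`. -/
def expMul (κ : ℝ) : Lp G 2 (timeMeas S) →L[ℝ] Lp G 2 (timeMeas S) :=
  mulOp ((memLp_exp S κ).toLp _)

theorem coeFn_expMul (κ : ℝ) (f : Lp G 2 (timeMeas S)) :
    expMul S κ f =ᵐ[timeMeas S] fun t => Real.exp (κ * t) • f t := by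
  filter_upwards [coeFn_mulOp ((memLp_exp S κ).toLp _) f, (memLp_exp S κ).coeFn_toLp]
    with t h1 h2
  exact h1.trans (by rw [h2])

theorem expMul_expMul_neg (κ : ℝ) (f : Lp G 2 (timeMeas S)) :
    expMul S κ (expMul S (-κ) f) = f := by
  refine Lp.ext ?_
  filter_upwards [coeFn_expMul κ (expMul S (-κ) f), coeFn_expMul (-κ) f] with t h1 h2
  rw [h1, h2, smul_smul, ← Real.exp_add]
  simp

theorem expMul_neg_expMul (κ : ℝ) (f : Lp G 2 (timeMeas S)) :
    expMul S (-κ) (expMul S κ f) = f := by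
  simpa using expMul_expMul_neg (-κ) f

theorem expMul_compLpL (κ : ℝ) (T : G →L[ℝ] G') (f : Lp G 2 (timeMeas S)) :
    expMul S κ (T.compLpL 2 _ f) = T.compLpL 2 _ (expMul S κ f) := by
  refine Lp.ext ?_
  filter_upwards [coeFn_expMul κ (T.compLpL 2 _ f), T.coeFn_compLpL (p := 2) f,
    T.coeFn_compLpL (p := 2) (expMul S κ f), coeFn_expMul κ f] with t h1 h2 h3 h4
  rw [h1, h2, h3, h4, map_smul]

/-- The bounded continuous function `s ↦ e^{κ s}` on `[0,S]`, constant elsewhere. -/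
def expClamp (S κ : ℝ) : ℝ →ᵇ ℝ :=
  BoundedContinuousFunction.ofNormedAddCommGroup (fun s => Real.exp (κ * max 0 (min s S)))
    (by fun_prop) (Real.exp (|κ| * |S|)) fun s => by
      rw [Real.norm_eq_abs, Real.abs_exp, Real.exp_le_exp]
      have h0 : 0 ≤ max 0 (min s S) := le_max_left _ _
      calc κ * max 0 (min s S) ≤ |κ| * max 0 (min s S) := by gcongr; exact le_abs_self κ
        _ ≤ |κ| * |S| := by
          gcongr
          exact max_le (abs_nonneg S) ((min_le_right _ _).trans (le_abs_self S))

theorem expClamp_apply (κ s : ℝ) : expClamp S κ s = Real.exp (κ * max 0 (min s S)) := rfl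

/-- Trajectories are bounded continuous functions on the whole line, so identities are needed at
every real s. Primitives and `expClamp` are both frozen outside [0,S]. -/
theorem setIntegral_Iic_timeMeas_clamp (hS : 0 ≤ S) {E : Type*} [NormedAddCommGroup E]
    [NormedSpace ℝ E] (f : ℝ → E) (s : ℝ) :
    ∫ t in Iic s, f t ∂(timeMeas S) = ∫ t in (0 : ℝ)..(max 0 (min s S)), f t := by
  rw [← setIntegral_Iic_timeMeas (S := S) f ⟨le_max_left _ _, max_le hS (min_le_right _ _)⟩,
    timeMeas, Measure.restrict_restrict measurableSet_Iic,
    Measure.restrict_restrict measurableSet_Iic]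
  congr 2
  ext x
  simp only [mem_inter_iff, mem_Iic, mem_Ioo]
  grind

theorem setIntegral_exp (hS : 0 ≤ S) (κ s : ℝ) :
    ∫ t in Iic s, κ * Real.exp (κ * t) ∂(timeMeas S) = expClamp S κ s - 1 := by
  rw [setIntegral_Iic_timeMeas_clamp hS, expClamp_apply,
    intervalIntegral.integral_eq_sub_of_hasDerivAt (f := fun t => Real.exp (κ * t))]
  · simp
  · intro t _
    have := ((hasDerivAt_id t).const_mul κ).exp
    simpa [mul_comm] using this
  · exact (by fun_prop : Continuous fun t => κ * Real.exp (κ * t)).intervalIntegrable _ _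

theorem ofCont_expClamp_smul (κ : ℝ) (v : ℝ →ᵇ G) :
    (ofCont (expClamp S κ • v) : Lp G 2 (timeMeas S)) = expMul S κ (ofCont v) := by
  refine Lp.ext ?_
  filter_upwards [coeFn_ofCont (S := S) (expClamp S κ • v), coeFn_ofCont (S := S) v,
    coeFn_expMul κ (ofCont v : Lp G 2 (timeMeas S)), ae_restrict_mem measurableSet_Ioo]
    with t h1 h2 h3 h4
  have h5 : (expClamp S κ • v) t = expClamp S κ t • v t := rfl
  rw [h1, h3, h2, h5, expClamp_apply, min_eq_left h4.2.le, max_eq_right h4.1.le]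

/-- The product rule for `s ↦ e^{κ s} (c + ∫₀ˢ g)`. -/
theorem expClamp_smul_const_add_prim (hS : 0 ≤ S) (κ : ℝ) (c : G) (g : Lp G 2 (timeMeas S))
    (s : ℝ) :
    expClamp S κ s • (c + prim g s) = c + prim (expMul S κ
      (g + κ • ofCont (BoundedContinuousFunction.const ℝ c + prim g))) s := by
  refine ext_inner_right ℝ fun ξ => ?_
  -- b is the derivative of e^{κt}ξ, so the product rule, paired with ξ, becomes integration by
  -- parts of g against b.
  set b : Lp G 2 (timeMeas S) :=
    expMul S κ (ofCont (BoundedContinuousFunction.const ℝ (κ • ξ))) with hb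
  have hbt : b =ᵐ[timeMeas S] fun t => (κ * Real.exp (κ * t)) • ξ := by
    filter_upwards [coeFn_expMul κ (ofCont (BoundedContinuousFunction.const ℝ (κ • ξ)) :
      Lp G 2 (timeMeas S)), coeFn_ofCont (S := S) (BoundedContinuousFunction.const ℝ (κ • ξ))]
      with t h1 h2
    rw [hb, h1, h2, BoundedContinuousFunction.const_apply, smul_smul, mul_comm]
  have hprim (t : ℝ) : prim b t = (expClamp S κ t - 1) • ξ := by
    rw [prim_apply, integral_congr_ae (ae_restrict_of_ae hbt), integral_smul_const,
      setIntegral_exp hS]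
  have hconst : ∫ t in Iic s, ⟪c, b t⟫_ℝ ∂(timeMeas S) = (expClamp S κ s - 1) * ⟪c, ξ⟫_ℝ := by
    rw [integral_inner (integrable_Lp_two b).integrableOn, ← prim_apply, hprim, inner_smul_right]
  have key := setIntegral_inner_prim g b s
  have i1 : Integrable (fun t => ⟪g t, prim b t⟫_ℝ) (timeMeas S) := by
    refine (L2.integrable_inner (𝕜 := ℝ) g (ofCont (prim b))).congr ?_
    filter_upwards [coeFn_ofCont (S := S) (prim b)] with t ht
    rw [ht]
  have i2 : Integrable (fun t => ⟪prim g t, b t⟫_ℝ) (timeMeas S) := by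
    refine (L2.integrable_inner (𝕜 := ℝ) (ofCont (prim g)) b).congr ?_
    filter_upwards [coeFn_ofCont (S := S) (prim g)] with t ht
    rw [ht]
  have i3 : Integrable (fun t => ⟪g t, ξ⟫_ℝ) (timeMeas S) := (integrable_Lp_two g).inner_const ξ
  have i4 : Integrable (fun t => ⟪c, b t⟫_ℝ) (timeMeas S) := (integrable_Lp_two b).const_inner c
  have e : ∫ t in Iic s, ⟪expMul S κ (g + κ • ofCont
        (BoundedContinuousFunction.const ℝ c + prim g)) t, ξ⟫_ℝ ∂(timeMeas S)
      = ∫ t in Iic s, ((⟪g t, prim b t⟫_ℝ + ⟪prim g t, b t⟫_ℝ) + (⟪g t, ξ⟫_ℝ + ⟪c, b t⟫_ℝ))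
          ∂(timeMeas S) := by
    refine integral_congr_ae (ae_restrict_of_ae ?_)
    filter_upwards [coeFn_expMul κ (g + κ • ofCont (BoundedContinuousFunction.const ℝ c + prim g)),
      Lp.coeFn_add g (κ • ofCont (BoundedContinuousFunction.const ℝ c + prim g)),
      Lp.coeFn_smul κ (ofCont (BoundedContinuousFunction.const ℝ c + prim g) :
        Lp G 2 (timeMeas S)),
      coeFn_ofCont (S := S) (BoundedContinuousFunction.const ℝ c + prim g), hbt,
      ae_restrict_mem measurableSet_Ioo] with t h1 h2 h3 h4 h5 h6
    rw [h1, h2, Pi.add_apply, h3, Pi.smul_apply, h4, h5, hprim, expClamp_apply,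
      min_eq_left h6.2.le, max_eq_right h6.1.le]
    simp only [BoundedContinuousFunction.add_apply, BoundedContinuousFunction.const_apply,
      inner_add_left, inner_smul_left, inner_smul_right, conj_trivial]
    ring
  have i12 : Integrable (fun t => ⟪g t, prim b t⟫_ℝ + ⟪prim g t, b t⟫_ℝ) (timeMeas S) := i1.add i2
  have i34 : Integrable (fun t => ⟪g t, ξ⟫_ℝ + ⟪c, b t⟫_ℝ) (timeMeas S) := i3.add i4
  rw [inner_add_left, inner_prim, e, integral_add i12.integrableOn i34.integrableOn,
    integral_add i1.integrableOn i2.integrableOn, key, integral_add i3.integrableOn i4.integrableOn,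
    hconst, hprim, ← inner_prim]
  simp only [inner_add_left, inner_smul_left, inner_smul_right, conj_trivial]
  ring

end Weights

/-! ### Solution operators -/

section Solve

variable {H V E : Type*} [NormedAddCommGroup H] [InnerProductSpace ℝ H] [CompleteSpace H]
  [NormedAddCommGroup V] [InnerProductSpace ℝ V] [CompleteSpace V]
  [NormedAddCommGroup E] [InnerProductSpace ℝ E] [CompleteSpace E]
  {ι : V →L[ℝ] H} {D : V →L[ℝ] E} {S : ℝ}

/-- The solution operator of `u' + D* D u + κ u = f`, `u(0) = v₀`, with values in `C([0,S];H)`. -/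
def solOp (ι : V →L[ℝ] H) (S κ : ℝ) :
    WithLp 2 (H × Lp H 2 (timeMeas S)) →L[ℝ] (ℝ →ᵇ H) :=
  (strongSol ι S).extendOfNorm (strongData ι S κ)

/-- The solution operator of `u' + D* D u + κ u = f`, `u(0) = v₀`, with values in `L²(0,S;V)`. -/
def solOpV (ι : V →L[ℝ] H) (S κ : ℝ) :
    WithLp 2 (H × Lp H 2 (timeMeas S)) →L[ℝ] Lp V 2 (timeMeas S) :=
  (strongSolV ι S).extendOfNorm (strongData ι S κ)

variable (hD : IsFormDomain ι D) {κ : ℝ} (hκ : 2 ≤ κ)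
include hD hκ

theorem solOp_strongData (x : WithLp 2 (H × Lp H 2 (timeMeas S))) :
    solOp ι S κ (strongData ι S κ x) = strongSol ι S x :=
  LinearMap.extendOfNorm_eq (denseRange_strongData hD (by linarith))
    ⟨1, norm_strongSol_le hκ⟩ x

theorem solOpV_strongData (x : WithLp 2 (H × Lp H 2 (timeMeas S))) :
    solOpV ι S κ (strongData ι S κ x) = strongSolV ι S x :=
  LinearMap.extendOfNorm_eq (denseRange_strongData hD (by linarith))
    ⟨1, norm_strongSolV_le' hκ⟩ x

theorem norm_solOpV_sq_le (y : WithLp 2 (H × Lp H 2 (timeMeas S))) :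
    ‖solOpV ι S κ y‖ ^ 2 ≤ 1 / 2 * ‖y.fst‖ ^ 2 + 1 / (2 * κ) * ‖y.snd‖ ^ 2 := by
  refine (denseRange_strongData (S := S) hD (by linarith : (0 : ℝ) ≤ κ)).induction_on y
    (isClosed_le ?_ ?_) fun x => ?_
  · fun_prop
  · fun_prop
  · rw [solOpV_strongData hD hκ]
    exact norm_strongSolV_le hκ x

theorem ofCont_solOp (y : WithLp 2 (H × Lp H 2 (timeMeas S))) :
    ofCont (solOp ι S κ y) = ι.compLpL 2 _ (solOpV ι S κ y) := by
  refine (denseRange_strongData (S := S) hD (by linarith : (0 : ℝ) ≤ κ)).induction_on y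
    (isClosed_eq ?_ ?_) fun x => ?_
  · fun_prop
  · fun_prop
  · rw [solOp_strongData hD hκ, solOpV_strongData hD hκ]
    refine Lp.ext ?_
    filter_upwards [coeFn_ofCont (S := S) (strongSol ι S x), coeFn_strongSolV (ι := ι) x,
      ι.coeFn_compLpL (p := 2) (strongSolV ι S x)] with t h1 h2 h3
    rw [h1, h3, h2, strongSol_apply, resolvent_apply]

/-- The exponentially rescaled solution operators solve `v' + D* D v = f`. -/
theorem isMildSolution_solOp (hS : 0 ≤ S) (y : WithLp 2 (H × Lp H 2 (timeMeas S))) :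
    IsMildSolution ι D y.fst (expMul S κ y.snd) (expClamp S κ • solOp ι S κ y)
      (expMul S κ (solOpV ι S κ y)) := by
  refine ⟨by rw [ofCont_expClamp_smul, ofCont_solOp hD hκ, expMul_compLpL], fun ψ s => ?_⟩
  change ⟪expClamp S κ s • solOp ι S κ y s, ι ψ⟫_ℝ + _ = _
  -- For fixed ψ and s both sides are continuous in y, so it suffices to treat strong data.
  refine (denseRange_strongData (S := S) hD (by linarith : (0 : ℝ) ≤ κ)).induction_on y
    (isClosed_eq ?_ ?_) fun x => ?_
  · have h1 : Continuous fun y => solOp ι S κ y s :=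
      (continuous_eval_const (F := ℝ →ᵇ H) s).comp (solOp ι S κ).continuous
    have h2 : Continuous fun y => prim (D.compLpL 2 _ (expMul S κ (solOpV ι S κ y))) s :=
      (continuous_eval_const (F := ℝ →ᵇ E) s).comp
        (prim ∘L D.compLpL 2 _ ∘L expMul S κ ∘L solOpV ι S κ).continuous
    fun_prop
  · have h2 : Continuous fun y : WithLp 2 (H × Lp H 2 (timeMeas S)) =>
        prim (expMul S κ y.snd) s :=
      (continuous_eval_const (F := ℝ →ᵇ H) s).comp
        (prim ∘L expMul S κ ∘L WithLp.sndL 2 ℝ H (Lp H 2 (timeMeas S))).continuous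
    fun_prop
  · rw [solOp_strongData hD hκ, solOpV_strongData hD hκ]
    set g := (resolvent ι).compLpL 2 _ x.snd
    set c := resolvent ι x.fst
    have hu : BoundedContinuousFunction.const ℝ c + prim g = strongSol ι S x := by
      ext t
      simp only [BoundedContinuousFunction.add_apply, BoundedContinuousFunction.const_apply]
      rw [prim_compLpL, strongSol_apply, traj_apply, map_add]
    have hus : strongSol ι S x s = c + prim g s := by rw [← hu]; rfl
    have hi1 : IntegrableOn (fun t => ⟪expMul S κ (g + κ • ofCont (strongSol ι S x)) t, ι ψ⟫_ℝ)
        (Iic s) (timeMeas S) := ((integrable_Lp_two _).inner_const _).integrableOn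
    have hi2 : IntegrableOn (fun t => ⟪D.compLpL 2 _ (expMul S κ (strongSolV ι S x)) t, D ψ⟫_ℝ)
        (Iic s) (timeMeas S) := ((integrable_Lp_two _).inner_const _).integrableOn
    -- After the product rule, all terms except the initial value are primitives. It remains to
    -- compare integrands, where D*D J = 1 - J gives Jw' + κJw + D*D Jw = f.
    rw [hus, expClamp_smul_const_add_prim hS, hu, inner_add_left, add_assoc, strongData_fst,
      add_right_inj, inner_prim, inner_prim, inner_prim, ← integral_add hi1 hi2]
    refine integral_congr_ae (ae_restrict_of_ae ?_)
    filter_upwards [coeFn_expMul κ (g + κ • ofCont (strongSol ι S x)),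
      Lp.coeFn_add g (κ • ofCont (strongSol ι S x)),
      Lp.coeFn_smul κ (ofCont (strongSol ι S x) : Lp H 2 (timeMeas S)),
      coeFn_ofCont (S := S) (strongSol ι S x),
      D.coeFn_compLpL (p := 2) (expMul S κ (strongSolV ι S x)),
      coeFn_expMul κ (strongSolV ι S x), coeFn_strongSolV (ι := ι) x,
      coeFn_expMul κ (strongData ι S κ x).snd, coeFn_strongData_snd (ι := ι) κ x,
      (resolvent ι).coeFn_compLpL (p := 2) x.snd] with t h1 h2 h3 h4 h5 h6 h7 h8 h9 h10
    rw [h1, h2, Pi.add_apply, h3, Pi.smul_apply, h4, h5, h6, h7, h8, h9, h10, map_smul,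
      inner_smul_left, inner_smul_left, hD.inner_D_adjoint, strongSol_apply]
    simp only [yosida, add_apply, sub_apply, ContinuousLinearMap.id_apply, smul_apply,
      inner_add_left, inner_sub_left, inner_smul_left, conj_trivial]
    ring

omit hκ in
/-- Well-posedness of `v' + D* D v + F v = φ`, `v(0) = v₀`, for a bounded perturbation `F` that
commutes with exponential weights in time. -/
theorem exists_solutionOperator (hS : 0 ≤ S) (F : Lp V 2 (timeMeas S) →L[ℝ] Lp H 2 (timeMeas S))
    (hF : ∀ c p, F (expMul S c p) = expMul S c (F p)) :
    ∃ T : WithLp 2 (H × Lp H 2 (timeMeas S)) →L[ℝ] (ℝ →ᵇ H), ∀ y,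
      (∃ p, IsMildSolution ι D y.fst (y.snd - F p) (T y) p) ∧
      ∀ v p, IsMildSolution ι D y.fst (y.snd - F p) v p → v = T y := by
  -- The 2 is required by the energy estimate. The ‖F‖² makes ‖F‖²/(2κ) ≤ 1/2, so the map `N` below
  -- has norm at most √(1/2).
  set κ : ℝ := 2 + ‖F‖ ^ 2 with hκdef
  have hκ : 2 ≤ κ := by simp [hκdef]; positivity
  set inr : Lp H 2 (timeMeas S) →L[ℝ] WithLp 2 (H × Lp H 2 (timeMeas S)) :=
    (WithLp.prodContinuousLinearEquiv 2 ℝ H (Lp H 2 (timeMeas S))).symm.toContinuousLinearMap ∘L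
      ContinuousLinearMap.inr ℝ H (Lp H 2 (timeMeas S)) with hinr
  have hinr_apply (f) : inr f = WithLp.toLp 2 (0, f) := rfl
  -- After rescaling by e^{-κs}, which commutes with F, the effective source f must satisfy f =
  -- e^{-κs}φ - F(solution with data (v₀, f)). Splitting off v₀ turns this into (1 - N)f = e^{-κs}φ
  -- - F(solution with data (v₀, 0)), which `src` solves.
  set N : Lp H 2 (timeMeas S) →L[ℝ] Lp H 2 (timeMeas S) := -(F ∘L solOpV ι S κ ∘L inr) with hN
  have hN_apply (f) : N f = -F (solOpV ι S κ (inr f)) := rfl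
  have hNnorm : ‖N‖ < 1 := by
    refine lt_of_le_of_lt (N.opNorm_le_bound (M := √(1 / 2)) (by positivity) fun f => ?_)
      (by rw [Real.sqrt_lt' one_pos]; norm_num)
    rw [hN_apply, norm_neg]
    refine le_of_sq_le_sq ?_ (by positivity)
    rw [mul_pow, Real.sq_sqrt (by norm_num)]
    have h1 : ‖solOpV ι S κ (inr f)‖ ^ 2 ≤ 1 / (2 * κ) * ‖f‖ ^ 2 := by
      simpa [hinr_apply] using norm_solOpV_sq_le hD hκ (inr f)
    calc ‖F (solOpV ι S κ (inr f))‖ ^ 2 ≤ (‖F‖ * ‖solOpV ι S κ (inr f)‖) ^ 2 := by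
          gcongr; exact F.le_opNorm _
      _ = ‖F‖ ^ 2 * ‖solOpV ι S κ (inr f)‖ ^ 2 := mul_pow _ _ _
      _ ≤ κ * (1 / (2 * κ) * ‖f‖ ^ 2) := by
          gcongr
          simp [hκdef]
      _ = 1 / 2 * ‖f‖ ^ 2 := by field_simp
  obtain ⟨U, hU⟩ := isUnit_one_sub_of_norm_lt_one (x := N) hNnorm
  have hU1 (f) : (↑U⁻¹ : Lp H 2 (timeMeas S) →L[ℝ] _) f
      - N ((↑U⁻¹ : Lp H 2 (timeMeas S) →L[ℝ] _) f) = f := by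
    have := congrArg (fun T : Lp H 2 (timeMeas S) →L[ℝ] _ => T f) U.mul_inv
    rw [hU] at this
    simpa using this
  have hU2 (f) (h : f = N f) : f = 0 := by
    have := congrArg (fun T : Lp H 2 (timeMeas S) →L[ℝ] _ => T f) U.inv_mul
    rw [hU] at this
    simpa [← h] using this.symm
  set fstL := WithLp.fstL 2 ℝ H (Lp H 2 (timeMeas S))
  set sndL := WithLp.sndL 2 ℝ H (Lp H 2 (timeMeas S))
  set inl : H →L[ℝ] WithLp 2 (H × Lp H 2 (timeMeas S)) :=
    (WithLp.prodContinuousLinearEquiv 2 ℝ H (Lp H 2 (timeMeas S))).symm.toContinuousLinearMap ∘L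
      ContinuousLinearMap.inl ℝ H (Lp H 2 (timeMeas S)) with hinl
  set src : WithLp 2 (H × Lp H 2 (timeMeas S)) →L[ℝ] Lp H 2 (timeMeas S) :=
    (↑U⁻¹ : Lp H 2 (timeMeas S) →L[ℝ] _) ∘L
      (expMul S (-κ) ∘L sndL - F ∘L solOpV ι S κ ∘L inl ∘L fstL) with hsrc
  set full : WithLp 2 (H × Lp H 2 (timeMeas S)) →L[ℝ] WithLp 2 (H × Lp H 2 (timeMeas S)) :=
    inl ∘L fstL + inr ∘L src with hfull
  have hfull_fst (y) : (full y).fst = y.fst := by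
    change y.fst + 0 = y.fst
    simp
  have hfull_snd (y) : (full y).snd = src y := by
    change 0 + src y = src y
    simp
  have hfull_eq (y) : expMul S κ (full y).snd
      = y.snd - F (expMul S κ (solOpV ι S κ (full y))) := by
    have h1 : src y = expMul S (-κ) y.snd - F (solOpV ι S κ (full y)) := by
      have := hU1 (expMul S (-κ) y.snd - F (solOpV ι S κ (inl y.fst)))
      have e : (↑U⁻¹ : Lp H 2 (timeMeas S) →L[ℝ] _)
        (expMul S (-κ) y.snd - F (solOpV ι S κ (inl y.fst))) = src y := rfl
      rw [e, hN_apply, sub_neg_eq_add] at this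
      have e2 : full y = inl y.fst + inr (src y) := rfl
      rw [e2, map_add, map_add, ← sub_sub, ← this]
      abel
    rw [hfull_snd, h1, map_sub, expMul_expMul_neg, hF]
  have hex (y) : IsMildSolution ι D y.fst (y.snd - F (expMul S κ (solOpV ι S κ (full y))))
      (expClamp S κ • solOp ι S κ (full y)) (expMul S κ (solOpV ι S κ (full y))) := by
    rw [← hfull_eq]
    nth_rewrite 1 [← hfull_fst y]
    exact isMildSolution_solOp hD hκ hS (full y)
  have huniq (v : ℝ →ᵇ H) (p : Lp V 2 (timeMeas S)) (h : IsMildSolution ι D 0 (-F p) v p) :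
      v = 0 := by
    -- Uniqueness for the unperturbed equation identifies q with the solution for the source -Fq.
    -- Thus -Fq is a fixed point of N, hence zero.
    set q := expMul S (-κ) p with hq
    have hp : p = expMul S κ q := by rw [hq, expMul_expMul_neg]
    have h1 := isMildSolution_solOp hD hκ hS (inr (-F q))
    have h2 : expMul S κ (inr (-F q)).snd = -F p := by
      rw [hinr_apply, WithLp.toLp_snd, map_neg, ← hF, ← hp]
    rw [h2] at h1
    have h3 := (h.sub h1)
    rw [sub_self, show (0 : H) - (inr (-F q)).fst = 0 by simp [hinr_apply]] at h3
    obtain ⟨h4, h5⟩ := h3.eq_zero hD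
    have h6 : q = solOpV ι S κ (inr (-F q)) := by
      rw [sub_eq_zero] at h5
      exact hq.trans ((congrArg _ h5).trans (expMul_neg_expMul _ _))
    have h7 : -F q = 0 := hU2 _ (by rw [hN_apply, ← h6])
    rw [h7, map_zero, map_zero, smul_zero, sub_zero] at h4
    exact h4
  refine ⟨(LinearMap.mkContinuous
    { toFun v := expClamp S κ • v
      map_add' _ _ := by ext s; exact smul_add _ _ _
      map_smul' c v := by ext s; exact smul_comm _ _ _ } ‖expClamp S κ‖ fun v => ?_) ∘L
    solOp ι S κ ∘L full, fun y => ⟨⟨_, hex y⟩, fun v p h => ?_⟩⟩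
  · refine (BoundedContinuousFunction.norm_le (by positivity)).2 fun s => ?_
    change ‖expClamp S κ s • v s‖ ≤ _
    rw [norm_smul]
    gcongr
    exacts [BoundedContinuousFunction.norm_coe_le_norm _ _,
      BoundedContinuousFunction.norm_coe_le_norm _ _]
  · have h1 := h.sub (hex y)
    rw [sub_self, show y.snd - F p - (y.snd - F (expMul S κ (solOpV ι S κ (full y))))
      = -F (p - expMul S κ (solOpV ι S κ (full y))) by rw [map_sub]; abel] at h1
    exact sub_eq_zero.1 (huniq _ _ h1)

end Solve

/-! ### The weighted Sobolev space `H¹(K)` -/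

section WeightedSobolev

variable {N : ℕ}

instance sigmaFinite_measK (N : ℕ) : SigmaFinite (measK N) :=
  SigmaFinite.withDensity_ofReal _

instance isLocallyFiniteMeasure_measK (N : ℕ) : IsLocallyFiniteMeasure (measK N) :=
  IsLocallyFiniteMeasure.withDensity_ofReal (by fun_prop)

theorem measK_absolutelyContinuous (N : ℕ) : measK N ≪ volume :=
  withDensity_absolutelyContinuous _ _

theorem volume_absolutelyContinuous_measK (N : ℕ) : (volume : Measure (Space N)) ≪ measK N :=
  withDensity_absolutelyContinuous' (by fun_prop) (.of_forall fun y => by simp [Real.exp_pos])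

/-- Since K ≥ 1, functions in L²(K) are locally integrable for Lebesgue measure, so the fundamental
lemma of the calculus of variations applies to them. -/
theorem volume_le_measK (N : ℕ) : (volume : Measure (Space N)) ≤ measK N := by
  conv_lhs => rw [← withDensity_one (μ := (volume : Measure (Space N)))]
  refine withDensity_mono (.of_forall fun y => ?_)
  simp only [Pi.one_apply]
  rw [← ENNReal.ofReal_one]
  exact ENNReal.ofReal_le_ofReal (Real.one_le_exp (by positivity))

theorem integral_measK (f : Space N → ℝ) :
    ∫ y, f y ∂(measK N) = ∫ y, Real.exp (‖y‖ ^ 2 / 4) * f y := by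
  rw [measK, integral_withDensity_eq_integral_toReal_smul (by fun_prop) (by simp)]
  refine integral_congr_ae (.of_forall fun y => ?_)
  simp only [smul_eq_mul]
  rw [ENNReal.toReal_ofReal (Real.exp_pos _).le]

theorem locallyIntegrable_L2K (u : L2K N) : LocallyIntegrable u (volume : Measure (Space N)) :=
  ((Lp.memLp u).mono_measure (volume_le_measK N)).locallyIntegrable (by norm_num)

theorem memLp_exp_neg_mul {χ : Space N → ℝ} (hχ : Continuous χ) (hc : HasCompactSupport χ) :
    MemLp (fun y => Real.exp (-(‖y‖ ^ 2 / 4)) * χ y) 2 (measK N) :=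
  Continuous.memLp_of_hasCompactSupport (by fun_prop) hc.mul_left

/-- The element of `L²(K)` whose inner product with `u` is `∫ u χ dy`. -/
def testVec (χ : Space N → ℝ) (hχ : Continuous χ) (hc : HasCompactSupport χ) : L2K N :=
  (memLp_exp_neg_mul hχ hc).toLp _

theorem inner_testVec (u : L2K N) (χ : Space N → ℝ) (hχ : Continuous χ)
    (hc : HasCompactSupport χ) : ⟪u, testVec χ hχ hc⟫_ℝ = ∫ y, u y * χ y := by
  rw [L2.inner_def]
  have h : ∫ y, ⟪u y, testVec χ hχ hc y⟫_ℝ ∂(measK N)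
      = ∫ y, u y * (Real.exp (-(‖y‖ ^ 2 / 4)) * χ y) ∂(measK N) := by
    refine integral_congr_ae ?_
    filter_upwards [(memLp_exp_neg_mul hχ hc).coeFn_toLp] with y hy
    rw [testVec, hy]
    simp [mul_comm]
  rw [h, integral_measK]
  refine integral_congr_ae (.of_forall fun y => ?_)
  simp only
  have : Real.exp (‖y‖ ^ 2 / 4) * Real.exp (-(‖y‖ ^ 2 / 4)) = 1 := by rw [← Real.exp_add]; simp
  linear_combination (u y * χ y) * this

theorem continuous_fderiv_apply {η : Space N → ℝ} (hη : ContDiff ℝ ∞ η) (e : Space N) :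
    Continuous fun y => fderiv ℝ η y e :=
  (hη.continuous_fderiv (by simp)).clm_apply continuous_const

/-- The unweighted integrals become L²(K) inner products with fixed vectors. Having weak gradient G
is thus a family of continuous linear conditions on (u, G), which makes H¹(K) a closed subspace. -/
theorem hasWeakGrad_iff {u : L2K N} {G : Fin N → L2K N} :
    HasWeakGrad u G ↔ ∀ (η : Space N → ℝ) (hη : ContDiff ℝ ∞ η) (hc : HasCompactSupport η)
      (j : Fin N), ⟪u, testVec _ (continuous_fderiv_apply hη (EuclideanSpace.single j 1))
        (hc.fderiv_apply (𝕜 := ℝ) _)⟫_ℝ + ⟪G j, testVec η hη.continuous hc⟫_ℝ = 0 := by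
  simp only [inner_testVec, HasWeakGrad, eq_neg_iff_add_eq_zero]

variable (N) in
/-- The Hilbert space `H¹(K)`, as the closed subspace of pairs `(u, ∇u)`. -/
def sobolev : Submodule ℝ (WithLp 2 (L2K N × PiLp 2 fun _ : Fin N => L2K N)) where
  carrier := {x | HasWeakGrad x.fst x.snd}
  add_mem' {x y} hx hy := by
    simp only [Set.mem_ofPred_eq, hasWeakGrad_iff] at hx hy ⊢
    intro η hη hc j
    simp only [WithLp.add_fst, WithLp.add_snd, PiLp.add_apply, inner_add_left]
    linarith [hx η hη hc j, hy η hη hc j]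
  zero_mem' := by
    simp only [Set.mem_ofPred_eq, hasWeakGrad_iff]
    intro η hη hc j
    simp
  smul_mem' c x hx := by
    simp only [Set.mem_ofPred_eq, hasWeakGrad_iff] at hx ⊢
    intro η hη hc j
    simp only [WithLp.smul_fst, WithLp.smul_snd, PiLp.smul_apply, inner_smul_left, conj_trivial]
    rw [← mul_add, hx η hη hc j, mul_zero]

theorem mem_sobolev {x : WithLp 2 (L2K N × PiLp 2 fun _ : Fin N => L2K N)} :
    x ∈ sobolev N ↔ HasWeakGrad x.fst x.snd := Iff.rfl

theorem isClosed_sobolev (N : ℕ) : IsClosed (sobolev N : Set (WithLp 2 (L2K N × PiLp 2 fun _ : Fin N => L2K N))) := by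
  have : (sobolev N : Set (WithLp 2 (L2K N × PiLp 2 fun _ : Fin N => L2K N)))
      = ⋂ (η : Space N → ℝ) (hη : ContDiff ℝ ∞ η) (hc : HasCompactSupport η) (j : Fin N),
        {x | ⟪x.fst, testVec _ (continuous_fderiv_apply hη (EuclideanSpace.single j 1))
        (hc.fderiv_apply (𝕜 := ℝ) _)⟫_ℝ + ⟪x.snd j, testVec η hη.continuous hc⟫_ℝ = 0} := by
    ext x
    simp only [SetLike.mem_coe, mem_sobolev, hasWeakGrad_iff, mem_iInter, Set.mem_ofPred_eq]
  rw [this]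
  refine isClosed_iInter fun η => isClosed_iInter fun hη => isClosed_iInter fun hc =>
    isClosed_iInter fun j => isClosed_eq ?_ continuous_const
  fun_prop

instance completeSpace_sobolev (N : ℕ) : CompleteSpace (sobolev N) :=
  (isClosed_sobolev N).completeSpace_coe

variable (N) in
/-- The Hilbert space `H¹(K)`. -/
def SobolevSpace : Type := sobolev N

instance : NormedAddCommGroup (SobolevSpace N) := inferInstanceAs (NormedAddCommGroup (sobolev N))

instance : InnerProductSpace ℝ (SobolevSpace N) := inferInstanceAs (InnerProductSpace ℝ (sobolev N))

instance : CompleteSpace (SobolevSpace N) := completeSpace_sobolev N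

variable (N) in
/-- The pair `(u, ∇u)` for `u ∈ H¹(K)`. -/
def sobolevGraph : SobolevSpace N →L[ℝ] WithLp 2 (L2K N × PiLp 2 fun _ : Fin N => L2K N) :=
  (sobolev N).subtypeL

variable (N) in
/-- The embedding `H¹(K) → L²(K)`. -/
def sobolevEmb : SobolevSpace N →L[ℝ] L2K N := WithLp.fstL 2 ℝ _ _ ∘L sobolevGraph N

variable (N) in
/-- The gradient `H¹(K) → L²(K)^N`. -/
def sobolevGrad : SobolevSpace N →L[ℝ] PiLp 2 fun _ : Fin N => L2K N :=
  WithLp.sndL 2 ℝ _ _ ∘L sobolevGraph N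

theorem sobolevEmb_apply (u : SobolevSpace N) : sobolevEmb N u = (sobolevGraph N u).fst := rfl

theorem sobolevGrad_apply (u : SobolevSpace N) : sobolevGrad N u = (sobolevGraph N u).snd := rfl

theorem hasWeakGrad_sobolev (u : SobolevSpace N) :
    HasWeakGrad (sobolevEmb N u) fun j => sobolevGrad N u j := Subtype.property (p := (· ∈ sobolev N)) u

theorem exists_sobolev_eq {u : L2K N} {G : Fin N → L2K N} (h : HasWeakGrad u G) :
    ∃ w : SobolevSpace N, sobolevEmb N w = u ∧ ∀ j, sobolevGrad N w j = G j :=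
  ⟨(⟨WithLp.toLp 2 (u, WithLp.toLp 2 G), h⟩ : sobolev N), rfl, fun _ => rfl⟩

variable (N) in
/-- The orthogonal projection onto `H¹(K)`. -/
def sobolevProj : WithLp 2 (L2K N × PiLp 2 fun _ : Fin N => L2K N) →L[ℝ] SobolevSpace N :=
  (sobolev N).orthogonalProjectionOnto

theorem sobolevGraph_proj {x : WithLp 2 (L2K N × PiLp 2 fun _ : Fin N => L2K N)}
    (hx : HasWeakGrad x.fst x.snd) : sobolevGraph N (sobolevProj N x) = x :=
  congrArg Subtype.val
    (Submodule.orthogonalProjectionOnto_mem_subspace_eq_self (K := sobolev N) ⟨x, hx⟩)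

theorem ae_eq_zero_of_integral_testFun {u : L2K N} (h : ∀ η : Space N → ℝ, ContDiff ℝ ∞ η →
    HasCompactSupport η → ∫ y, u y * η y = 0) : u = 0 := by
  refine (Lp.eq_zero_iff_ae_eq_zero).2 (measK_absolutelyContinuous N ?_)
  refine ae_eq_zero_of_integral_contDiff_smul_eq_zero (locallyIntegrable_L2K u) fun η hη hc => ?_
  simpa only [smul_eq_mul, mul_comm] using h η hη hc

theorem memLp_testFun {η : Space N → ℝ} (hη : Continuous η) (hc : HasCompactSupport η) :
    MemLp η 2 (measK N) := hη.memLp_of_hasCompactSupport hc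

/-- Test functions belong to `H¹(K)`. -/
theorem hasWeakGrad_testFun {η : Space N → ℝ} (hη : ContDiff ℝ ∞ η) (hc : HasCompactSupport η) :
    HasWeakGrad ((memLp_testFun hη.continuous hc).toLp η) fun j =>
      (memLp_testFun (continuous_fderiv_apply hη (EuclideanSpace.single j 1))
        (hc.fderiv_apply (𝕜 := ℝ) _)).toLp _ := by
  intro θ hθ hcθ j
  have hη' := continuous_fderiv_apply hη (EuclideanSpace.single j 1)
  have hθ' := continuous_fderiv_apply hθ (EuclideanSpace.single j 1)
  have h1 : ∀ᵐ y, (memLp_testFun hη.continuous hc).toLp η y = η y :=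
    volume_absolutelyContinuous_measK N (memLp_testFun hη.continuous hc).coeFn_toLp
  have h2 := volume_absolutelyContinuous_measK N
    (memLp_testFun hη' (hc.fderiv_apply (𝕜 := ℝ) _)).coeFn_toLp
  simp only
  rw [integral_congr_ae (g := fun y => η y * fderiv ℝ θ y (EuclideanSpace.single j 1))
      (by filter_upwards [h1] with y hy; rw [hy]),
    integral_congr_ae (g := fun y => fderiv ℝ η y (EuclideanSpace.single j 1) * θ y)
      (f := fun y => ((memLp_testFun hη' (hc.fderiv_apply (𝕜 := ℝ) _)).toLp _ : L2K N) y * θ y)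
      (by filter_upwards [h2] with y hy; rw [hy])]
  refine integral_mul_fderiv_eq_neg_fderiv_mul_of_integrable ?_ ?_ ?_
    (fun x _ => (hη.differentiable (by simp)) x) (fun x _ => (hθ.differentiable (by simp)) x)
  · exact (hη'.mul hθ.continuous).integrable_of_hasCompactSupport hcθ.mul_left
  · exact (hη.continuous.mul hθ').integrable_of_hasCompactSupport hc.mul_right
  · exact (hη.continuous.mul hθ.continuous).integrable_of_hasCompactSupport hc.mul_right

theorem isFormDomain_sobolev (N : ℕ) : IsFormDomain (sobolevEmb N) (sobolevGrad N) where
  inner_eq _ _ := rfl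
  injective := by
    refine (injective_iff_map_eq_zero _).2 fun u hu => ?_
    have h2 : sobolevGrad N u = 0 := by
      ext1 j
      refine ae_eq_zero_of_integral_testFun fun η hη hc => ?_
      have := hasWeakGrad_iff.1 (hasWeakGrad_sobolev u) η hη hc j
      rwa [hu, inner_zero_left, zero_add, inner_testVec] at this
    exact Subtype.ext (WithLp.ofLp_injective 2 (Prod.ext hu h2))
  denseRange := by
    have : (LinearMap.range (sobolevEmb N : SobolevSpace N →ₗ[ℝ] L2K N)).topologicalClosure
        = ⊤ := by
      rw [Submodule.topologicalClosure_eq_top_iff, Submodule.eq_bot_iff]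
      intro w hw
      have hw' (u : SobolevSpace N) : ⟪sobolevEmb N u, w⟫_ℝ = 0 := hw _ ⟨u, rfl⟩
      refine ae_eq_zero_of_integral_testFun fun η hη hc => ?_
      -- Dividing the test function by K turns orthogonality in L²(K) into the unweighted statement
      -- ∫ w η dy = 0.
      have hη2 : ContDiff ℝ ∞ fun y => Real.exp (-(‖y‖ ^ 2 / 4)) * η y :=
        (((contDiff_norm_sq ℝ).div_const 4).neg.exp).mul hη
      obtain ⟨u, hu, -⟩ := exists_sobolev_eq (hasWeakGrad_testFun hη2 hc.mul_left)
      have h := hw' u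
      rw [← inner_testVec w η hη.continuous hc, ← h, real_inner_comm, hu]
      rfl
    intro y
    have h : y ∈ (LinearMap.range
        (sobolevEmb N : SobolevSpace N →ₗ[ℝ] L2K N)).topologicalClosure :=
      this ▸ Submodule.mem_top
    rwa [← SetLike.mem_coe, Submodule.topologicalClosure_coe, LinearMap.coe_range] at h

end WeightedSobolev

/-! ### Multiplication by bounded functions of space and time -/

/-- A map into a separable metric space is measurable when its distances to fixed points are. -/
theorem measurable_of_measurable_dist {α X : Type*} [MeasurableSpace α] [PseudoMetricSpace X]
    [SecondCountableTopology X] [MeasurableSpace X] [BorelSpace X] {f : α → X}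
    (hf : ∀ x, Measurable fun a => dist (f a) x) : Measurable f := by
  refine measurable_of_isOpen fun U hU => ?_
  choose! r hr using fun x (hx : x ∈ U) => Metric.isOpen_iff.1 hU x hx
  obtain ⟨T, hT, hTU⟩ := TopologicalSpace.isOpen_iUnion_countable
    (fun x : U => Metric.ball x.1 (r x)) fun _ => Metric.isOpen_ball
  have hU' : U = ⋃ x ∈ T, Metric.ball x.1 (r x) := by
    rw [hTU]
    refine Subset.antisymm (fun x hx => mem_iUnion.2 ⟨⟨x, hx⟩, ?_⟩)
      (iUnion_subset fun x => (hr x x.2).2)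
    exact Metric.mem_ball_self (hr x hx).1
  rw [hU', preimage_iUnion₂]
  exact MeasurableSet.biUnion hT fun x _ => measurableSet_lt (hf x) measurable_const

instance secondCountableTopology_L2K (N : ℕ) : SecondCountableTopology (L2K N) :=
  haveI : Fact ((2 : ℝ≥0∞) ≠ ⊤) := ⟨by simp⟩
  Lp.SecondCountableTopology

section FiberMul

variable {N : ℕ} {S : ℝ} {m : ℝ → Space N → ℝ} {C : ℝ}

theorem memLp_fiber (hm : Measurable (Function.uncurry m)) (hC : ∀ s y, ‖m s y‖ ≤ C) (s : ℝ) :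
    MemLp (m s) ∞ (measK N) :=
  memLp_top_of_bound (hm.comp measurable_prodMk_left).aestronglyMeasurable C (.of_forall (hC s))

/-- Multiplication by `m(s,·)` on `L²(K)`. -/
def fiberOp (hm : Measurable (Function.uncurry m)) (hC : ∀ s y, ‖m s y‖ ≤ C) (s : ℝ) :
    L2K N →L[ℝ] L2K N := mulOp ((memLp_fiber hm hC s).toLp _)

variable (hm : Measurable (Function.uncurry m)) (hC : ∀ s y, ‖m s y‖ ≤ C)

theorem coeFn_fiberOp (s : ℝ) (u : L2K N) :
    fiberOp hm hC s u =ᵐ[measK N] fun y => m s y * u y := by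
  filter_upwards [coeFn_mulOp ((memLp_fiber hm hC s).toLp _) u,
    (memLp_fiber hm hC s).coeFn_toLp] with y h1 h2
  exact h1.trans (by rw [h2]; rfl)

theorem norm_fiberOp_le (s : ℝ) (u : L2K N) : ‖fiberOp hm hC s u‖ ≤ C * ‖u‖ := by
  refine Lp.norm_le_mul_norm_of_ae_le_mul ?_
  filter_upwards [coeFn_fiberOp hm hC s u] with y h1
  rw [h1, norm_mul]
  gcongr
  exact hC s y

/-- L^∞ is not separable in general, so measurability is checked on each vector u. In the separable
space L²(K) it suffices that distances to fixed points be measurable, and these are square roots of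
integrals depending on the parameter s. -/
theorem stronglyMeasurable_fiberOp (u : L2K N) : StronglyMeasurable fun s => fiberOp hm hC s u := by
  borelize (L2K N)
  refine (measurable_of_measurable_dist fun w => ?_).stronglyMeasurable
  have h1 (s : ℝ) : dist (fiberOp hm hC s u) w
      = √(∫ y, (m s y * u y - w y) ^ 2 ∂(measK N)) := by
    rw [dist_eq_norm, ← Real.sqrt_sq (norm_nonneg (fiberOp hm hC s u - w)), norm_sq_Lp_two]
    congr 1
    refine integral_congr_ae ?_
    filter_upwards [coeFn_fiberOp hm hC s u, Lp.coeFn_sub (fiberOp hm hC s u) w] with y h1 h2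
    rw [h2, Pi.sub_apply, h1, Real.norm_eq_abs, sq_abs]
  simp only [h1]
  refine Measurable.sqrt ?_
  have h2 : StronglyMeasurable fun p : ℝ × Space N => (m p.1 p.2 * u p.2 - w p.2) ^ 2 := by
    refine Measurable.stronglyMeasurable ?_
    exact ((hm.mul ((Lp.stronglyMeasurable u).measurable.comp measurable_snd)).sub
      ((Lp.stronglyMeasurable w).measurable.comp measurable_snd)).pow_const 2
  exact h2.integral_prod_right'.measurable

/-- A Carathéodory argument: the map (u, s) ↦ m(s,·)u is continuous in u and measurable in s, hence
jointly measurable. -/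
theorem aestronglyMeasurable_fiberOp (h : Control N S) :
    AEStronglyMeasurable (fun s => fiberOp hm hC s (h s)) (timeMeas S) := by
  borelize (L2K N)
  have h1 : StronglyMeasurable (Function.uncurry fun u s => fiberOp hm hC s u) :=
    stronglyMeasurable_uncurry_of_continuous_of_stronglyMeasurable
      (fun s => (fiberOp hm hC s).continuous) (stronglyMeasurable_fiberOp hm hC)
  exact (h1.comp_measurable
    ((Lp.stronglyMeasurable h).measurable.prodMk measurable_id)).aestronglyMeasurable

theorem memLp_fiberOp (h : Control N S) :
    MemLp (fun s => fiberOp hm hC s (h s)) 2 (timeMeas S) :=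
  (Lp.memLp h).of_le_mul (aestronglyMeasurable_fiberOp hm hC h)
    (.of_forall fun s => norm_fiberOp_le hm hC s (h s))

variable (S) in
/-- Multiplication by the bounded function `m(s,y)` on `L²(0,S;L²(K))`. -/
def fiberMul : Control N S →L[ℝ] Control N S :=
  LinearMap.mkContinuous
    { toFun h := (memLp_fiberOp hm hC h).toLp _
      map_add' h k := by
        rw [← MemLp.toLp_add, MemLp.toLp_eq_toLp_iff]
        filter_upwards [Lp.coeFn_add h k] with s hs
        rw [hs, Pi.add_apply, map_add, Pi.add_apply]
      map_smul' c h := by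
        rw [RingHom.id_apply, ← MemLp.toLp_const_smul, MemLp.toLp_eq_toLp_iff]
        filter_upwards [Lp.coeFn_smul c h] with s hs
        rw [hs, Pi.smul_apply, map_smul, Pi.smul_apply] }
    C fun h => by
      refine Lp.norm_le_mul_norm_of_ae_le_mul ?_
      filter_upwards [(memLp_fiberOp hm hC h).coeFn_toLp] with s hs
      exact (congrArg norm hs).trans_le (norm_fiberOp_le hm hC s (h s))

theorem coeFn_fiberMul (h : Control N S) :
    fiberMul S hm hC h =ᵐ[timeMeas S] fun s => fiberOp hm hC s (h s) :=
  (memLp_fiberOp hm hC h).coeFn_toLp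

theorem ae_ae_fiberMul (h : Control N S) :
    ∀ᵐ s ∂(timeMeas S), ∀ᵐ y ∂(measK N), fiberMul S hm hC h s y = m s y * h s y := by
  filter_upwards [coeFn_fiberMul hm hC h] with s hs
  rw [hs]
  exact coeFn_fiberOp hm hC s (h s)

theorem fiberMul_expMul (c : ℝ) (h : Control N S) :
    fiberMul S hm hC (expMul S c h) = expMul S c (fiberMul S hm hC h) := by
  refine Lp.ext ?_
  filter_upwards [coeFn_fiberMul hm hC (expMul S c h), coeFn_fiberMul hm hC h,
    coeFn_expMul c h, coeFn_expMul c (fiberMul S hm hC h)] with s h1 h2 h3 h4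
  rw [h1, h4, h2, h3, map_smul]

/-- A measurable version truncated at the essential supremum makes every time slice a bounded
multiplier. Fubini preserves equality on almost every slice. -/
theorem exists_bounded_representative {A : ℝ → Space N → ℝ}
    (hA : MemLp (fun p : ℝ × Space N => A p.1 p.2) ∞ ((timeMeas S).prod volume)) :
    ∃ (a : ℝ → Space N → ℝ) (C : ℝ), Measurable (Function.uncurry a) ∧ (∀ s y, ‖a s y‖ ≤ C) ∧
      ∀ᵐ s ∂(timeMeas S), ∀ᵐ y ∂(measK N), A s y = a s y := by
  set C := (eLpNorm (fun p : ℝ × Space N => A p.1 p.2) ∞ ((timeMeas S).prod volume)).toReal with hC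
  have hC0 : 0 ≤ C := ENNReal.toReal_nonneg
  set f := hA.aestronglyMeasurable.mk with hf
  have hb : ∀ᵐ p ∂((timeMeas S).prod volume), ‖A p.1 p.2‖ ≤ C := by
    filter_upwards [ae_le_eLpNormEssSup (f := fun p : ℝ × Space N => A p.1 p.2)
      (μ := (timeMeas S).prod volume)] with p hp
    rw [hC, eLpNorm_exponent_top, ← toReal_enorm]
    refine ENNReal.toReal_mono ?_ hp
    rw [← eLpNorm_exponent_top]
    exact hA.2.ne
  refine ⟨fun s y => max (-C) (min C (f (s, y))), C, ?_, fun s y => ?_, ?_⟩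
  · exact measurable_const.max (measurable_const.min
      hA.aestronglyMeasurable.stronglyMeasurable_mk.measurable)
  · rw [Real.norm_eq_abs, abs_le]
    exact ⟨le_max_left _ _, max_le (by linarith) (min_le_left _ _)⟩
  · have h : ∀ᵐ p ∂((timeMeas S).prod volume), A p.1 p.2 = max (-C) (min C (f p)) := by
      filter_upwards [hb, hA.aestronglyMeasurable.ae_eq_mk] with p h1 h2
      rw [← hf] at h2
      rw [Real.norm_eq_abs, abs_le] at h1
      rw [← h2, min_eq_right h1.2, max_eq_right h1.1]
    filter_upwards [Measure.ae_ae_of_ae_prod h] with s hs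
    exact measK_absolutelyContinuous N hs

end FiberMul

/-! ### Localization to the moving regions -/

section Region

variable {N : ℕ} {S : ℝ} {U : Set (Space N)}

theorem mem_region {s : ℝ} {y : Space N} : y ∈ region U s ↔ Real.exp (s / 2) • y ∈ U := by
  rw [region, mem_smul_set_iff_inv_smul_mem₀ (Real.exp_pos _).ne', ← Real.exp_neg]
  congr! 2
  ring_nf

open Classical in
/-- The indicator function of the moving region. -/
def regionInd (U : Set (Space N)) (s : ℝ) (y : Space N) : ℝ := (region U s).indicator 1 y

theorem measurableSet_region (hU : IsOpen U) (s : ℝ) : MeasurableSet (region U s) := by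
  have : region U s = (fun y => Real.exp (s / 2) • y) ⁻¹' U := by ext; exact mem_region
  rw [this]
  exact (hU.preimage (by fun_prop)).measurableSet

theorem measurable_regionInd (hU : IsOpen U) : Measurable (Function.uncurry (regionInd U)) := by
  have : Function.uncurry (regionInd U)
      = ((fun p : ℝ × Space N => Real.exp (p.1 / 2) • p.2) ⁻¹' U).indicator 1 := by
    ext ⟨s, y⟩
    by_cases hy : y ∈ region U s
    · have hy' := mem_region.1 hy
      simp [Function.uncurry, regionInd, hy, hy']
    · have hy' := mt mem_region.2 hy
      simp [Function.uncurry, regionInd, hy, hy']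
  rw [this]
  exact measurable_one.indicator (hU.preimage (by fun_prop)).measurableSet

theorem norm_regionInd_le (U : Set (Space N)) (s : ℝ) (y : Space N) : ‖regionInd U s y‖ ≤ 1 := by
  rw [regionInd, indicator]
  split_ifs <;> simp

variable (S) in
/-- Restriction of a control to the moving region. -/
def restrictRegion (hU : IsOpen U) : Control N S →L[ℝ] Control N S :=
  fiberMul S (measurable_regionInd hU) (norm_regionInd_le U)

theorem ae_ae_restrictRegion (hU : IsOpen U) (h : Control N S) :
    ∀ᵐ s ∂(timeMeas S), restrictRegion S hU h s =ᵐ[measK N] localize U h s := by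
  filter_upwards [ae_ae_fiberMul (measurable_regionInd hU) (norm_regionInd_le U) h] with s hs
  filter_upwards [hs] with y hy
  refine hy.trans ?_
  by_cases hy' : y ∈ region U s <;> simp [regionInd, localize, hy']

theorem restrictRegion_idem (hU : IsOpen U) (h : Control N S) :
    restrictRegion S hU (restrictRegion S hU h) = restrictRegion S hU h := by
  refine Lp.ext ?_
  filter_upwards [ae_ae_restrictRegion hU h, ae_ae_restrictRegion hU (restrictRegion S hU h)]
    with s h1 h2
  refine Lp.ext ?_
  filter_upwards [h1, h2] with y h3 h4
  rw [h4]
  by_cases hy : y ∈ region U s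
  · simp [localize, hy]
  · rw [h3]
    simp [localize, hy]

/-- Together with `restrictRegion_idem`, this makes restriction to the moving region an orthogonal
projection. -/
theorem restrictRegion_symm (hU : IsOpen U) (h k : Control N S) :
    ⟪restrictRegion S hU h, k⟫_ℝ = ⟪h, restrictRegion S hU k⟫_ℝ := by
  rw [L2.inner_def, L2.inner_def]
  refine integral_congr_ae ?_
  filter_upwards [ae_ae_restrictRegion hU h, ae_ae_restrictRegion hU k] with s h1 h2
  rw [L2.inner_def, L2.inner_def]
  refine integral_congr_ae ?_
  filter_upwards [h1, h2] with y h3 h4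
  rw [h3, h4]
  by_cases hy : y ∈ region U s <;> simp [localize, hy]

theorem ae_ae_source {n : ℕ} {O : Set (Space N)} {Oi : Fin n → Set (Space N)} (hO : IsOpen O)
    (hOi : ∀ i, IsOpen (Oi i)) (g : Control N S) (h : Fin n → Control N S) :
    ∀ᵐ s ∂(timeMeas S), source O Oi g h s =ᵐ[measK N]
      (restrictRegion S hO g + ∑ i, restrictRegion S (hOi i) (h i) : Control N S) s := by
  filter_upwards [Lp.coeFn_add (restrictRegion S hO g) (∑ i, restrictRegion S (hOi i) (h i)),
    Lp.coeFn_finsetSum Finset.univ fun i => restrictRegion S (hOi i) (h i),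
    ae_ae_restrictRegion hO g, ae_all_iff.2 fun i => ae_ae_restrictRegion (hOi i) (h i)]
    with s h1 h2 h3 h4
  rw [h1, Pi.add_apply, h2, Finset.sum_apply]
  filter_upwards [Lp.coeFn_add (restrictRegion S hO g s) (∑ i, restrictRegion S (hOi i) (h i) s),
    Lp.coeFn_finsetSum Finset.univ fun i => restrictRegion S (hOi i) (h i) s, h3,
    ae_all_iff.2 h4] with y h5 h6 h7 h8
  rw [h5, Pi.add_apply, h6, Finset.sum_apply, h7]
  simp only [source, h8]

end Region

/-! ### Well-posedness of the state equation -/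

section State

variable {N : ℕ} {S : ℝ} {A : ℝ → Space N → ℝ} {B : ℝ → Space N → Space N}

theorem inner_L2K (u ψ : L2K N) : ⟪u, ψ⟫_ℝ = ∫ y, u y * ψ y ∂(measK N) := by
  rw [L2.inner_def]
  refine integral_congr_ae (.of_forall fun y => ?_)
  simp [mul_comm]

/-! ### Lower order terms and the abstract form of the weak equation -/

section LowerOrder

variable {V : Type*} [NormedAddCommGroup V] [InnerProductSpace ℝ V] [CompleteSpace V]

/-- The lower order terms `A v + B · ∇v - (N/2) v` as a bounded operator from `L²(0,S;V)` to `L²(0,S;L²(K))`. -/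
theorem exists_lowerOrder (ι : V →L[ℝ] L2K N) (D : V →L[ℝ] PiLp 2 fun _ : Fin N => L2K N)
    (hA : MemLp (fun p : ℝ × Space N => A p.1 p.2) ∞ ((timeMeas S).prod volume))
    (hB : MemLp (fun p : ℝ × Space N => B p.1 p.2) ∞ ((timeMeas S).prod volume)) :
    ∃ F : Lp V 2 (timeMeas S) →L[ℝ] Control N S,
      (∀ c p, F (expMul S c p) = expMul S c (F p)) ∧
      ∀ p : Lp V 2 (timeMeas S), ∀ᵐ s ∂(timeMeas S), ∀ ψ : L2K N,
        ⟪F p s, ψ⟫_ℝ = (∫ y, A s y * ι (p s) y * ψ y ∂(measK N))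
          + (∫ y, (∑ j, B s y j * D (p s) j y) * ψ y ∂(measK N))
          - (N : ℝ) / 2 * ⟪ι (p s), ψ⟫_ℝ := by
  obtain ⟨a, C, ha, hC, haA⟩ := exists_bounded_representative hA
  have hBj (j : Fin N) := exists_bounded_representative (A := fun s y => B s y j)
    ((EuclideanSpace.proj j : Space N →L[ℝ] ℝ).comp_memLp' hB)
  choose b Cb hb hCb hbB using hBj
  set Dj : Fin N → (V →L[ℝ] L2K N) := fun j =>
    PiLp.proj 2 (fun _ : Fin N => L2K N) j ∘L D with hDj
  set F : Lp V 2 (timeMeas S) →L[ℝ] Control N S :=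
    fiberMul S ha hC ∘L ι.compLpL 2 (timeMeas S)
      + ∑ j, fiberMul S (hb j) (hCb j) ∘L (Dj j).compLpL 2 (timeMeas S)
      - ((N : ℝ) / 2) • ι.compLpL 2 (timeMeas S) with hF
  have hFp (p : Lp V 2 (timeMeas S)) :
      F p = fiberMul S ha hC (ι.compLpL 2 (timeMeas S) p)
        + ∑ j, fiberMul S (hb j) (hCb j) ((Dj j).compLpL 2 (timeMeas S) p)
        - ((N : ℝ) / 2) • ι.compLpL 2 (timeMeas S) p := by
    simp only [hF, add_apply, sub_apply, smul_apply, sum_apply,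
      ContinuousLinearMap.comp_apply]
  refine ⟨F, fun c p => ?_, fun p => ?_⟩
  · have e1 : ι.compLpL 2 (timeMeas S) (expMul S c p)
        = expMul S c (ι.compLpL 2 (timeMeas S) p) :=
      (expMul_compLpL c ι p).symm
    have e2 (j : Fin N) : (Dj j).compLpL 2 (timeMeas S) (expMul S c p)
        = expMul S c ((Dj j).compLpL 2 (timeMeas S) p) := (expMul_compLpL c (Dj j) p).symm
    simp only [hFp, map_sub, map_add, map_sum, map_smul, e1, e2, fiberMul_expMul]
  · filter_upwards [
      Lp.coeFn_sub (fiberMul S ha hC (ι.compLpL 2 (timeMeas S) p)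
        + ∑ j, fiberMul S (hb j) (hCb j) ((Dj j).compLpL 2 (timeMeas S) p))
        (((N : ℝ) / 2) • ι.compLpL 2 (timeMeas S) p),
      Lp.coeFn_add (fiberMul S ha hC (ι.compLpL 2 (timeMeas S) p))
        (∑ j, fiberMul S (hb j) (hCb j) ((Dj j).compLpL 2 (timeMeas S) p)),
      Lp.coeFn_smul ((N : ℝ) / 2) (ι.compLpL 2 (timeMeas S) p),
      Lp.coeFn_finsetSum Finset.univ fun j =>
        fiberMul S (hb j) (hCb j) ((Dj j).compLpL 2 (timeMeas S) p),
      coeFn_fiberMul ha hC (ι.compLpL 2 (timeMeas S) p),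
      ae_all_iff.2 fun j => coeFn_fiberMul (hb j) (hCb j) ((Dj j).compLpL 2 (timeMeas S) p),
      ι.coeFn_compLpL (p := 2) (μ := timeMeas S) p,
      ae_all_iff.2 fun j => (Dj j).coeFn_compLpL (p := 2) (μ := timeMeas S) p,
      haA, ae_all_iff.2 hbB] with s h1 h2 h3 h4 h5 h6 h7 h8 h9 h10 ψ
    rw [hFp, h1, Pi.sub_apply, h2, Pi.add_apply, h3, Pi.smul_apply, h4, Finset.sum_apply, h5]
    simp only [h6, h7, h8]
    rw [inner_sub_left, inner_add_left, inner_smul_left, conj_trivial, inner_L2K, inner_L2K]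
    congr 1
    congr 1
    · refine integral_congr_ae ?_
      filter_upwards [coeFn_fiberOp ha hC s (ι (p s)), h9] with y h11 h12
      rw [h11, h12]
    · refine integral_congr_ae ?_
      filter_upwards [Lp.coeFn_finsetSum Finset.univ fun j =>
          fiberOp (hb j) (hCb j) s (Dj j (p s)),
        ae_all_iff.2 fun j => coeFn_fiberOp (hb j) (hCb j) s (Dj j (p s)),
        ae_all_iff.2 h10] with y h11 h12 h13
      rw [h11, Finset.sum_apply]
      simp only [h12, h13]
      rfl

/-- The integrand of the weak formulation, in abstract form. -/
theorem ae_weakForm_eq {ι : V →L[ℝ] L2K N} {D : V →L[ℝ] PiLp 2 fun _ : Fin N => L2K N}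
    {F : Lp V 2 (timeMeas S) →L[ℝ] Control N S}
    {p : Lp V 2 (timeMeas S)} (hF : ∀ᵐ s ∂(timeMeas S), ∀ ψ : L2K N,
        ⟪F p s, ψ⟫_ℝ = (∫ y, A s y * ι (p s) y * ψ y ∂(measK N))
          + (∫ y, (∑ j, B s y j * D (p s) j y) * ψ y ∂(measK N))
          - (N : ℝ) / 2 * ⟪ι (p s), ψ⟫_ℝ)
    {v : ℝ → L2K N} {G : ℝ → Fin N → L2K N}
    (hv : ∀ᵐ s ∂(timeMeas S), ι (p s) = v s)
    (hG : ∀ᵐ s ∂(timeMeas S), ∀ j, D (p s) j = G s j) (ψ : V)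
    {s : ℝ} (hs : s ∈ Icc 0 S) :
    ∫ τ in (0 : ℝ)..s,
          ((∑ j, ⟪G τ j, D ψ j⟫_ℝ)
            + (∫ y, A τ y * v τ y * ι ψ y ∂(measK N))
            + (∫ y, (∑ j, B τ y j * G τ j y) * ι ψ y ∂(measK N))
            - (N : ℝ) / 2 * ⟪v τ, ι ψ⟫_ℝ)
      = ⟪prim ((D).compLpL 2 (timeMeas S) p) s, D ψ⟫_ℝ
        + ⟪prim (F p) s, ι ψ⟫_ℝ := by
  have i1 : IntegrableOn (fun t => ⟪(D).compLpL 2 (timeMeas S) p t,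
      D ψ⟫_ℝ) (Iic s) (timeMeas S) := ((integrable_Lp_two _).inner_const _).integrableOn
  have i2 : IntegrableOn (fun t => ⟪F p t, ι ψ⟫_ℝ) (Iic s) (timeMeas S) :=
    ((integrable_Lp_two _).inner_const _).integrableOn
  rw [← setIntegral_Iic_timeMeas _ hs, inner_prim, inner_prim, ← integral_add i1 i2]
  refine integral_congr_ae (ae_restrict_of_ae ?_)
  filter_upwards [hF, hv, hG, (D).coeFn_compLpL (p := 2) (μ := timeMeas S) p]
    with τ h1 h2 h3 h4
  rw [h1, h4, PiLp.inner_apply, h2]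
  simp only [h3]
  ring

end LowerOrder

theorem integral_source_eq {φ : ℝ → Space N → ℝ} {Φ : Control N S}
    (hφ : ∀ᵐ s ∂(timeMeas S), φ s =ᵐ[measK N] Φ s) (ψ : L2K N) {s : ℝ} (hs : s ∈ Icc 0 S) :
    ∫ τ in (0 : ℝ)..s, ∫ y, φ τ y * ψ y ∂(measK N) = ⟪prim Φ s, ψ⟫_ℝ := by
  rw [← setIntegral_Iic_timeMeas _ hs, inner_prim]
  refine integral_congr_ae (ae_restrict_of_ae ?_)
  filter_upwards [hφ] with τ h1
  rw [inner_L2K]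
  refine integral_congr_ae ?_
  filter_upwards [h1] with y h2
  rw [h2]

variable {F : Lp (SobolevSpace N) 2 (timeMeas S) →L[ℝ] Control N S}
  (hF : ∀ p : Lp (SobolevSpace N) 2 (timeMeas S), ∀ᵐ s ∂(timeMeas S), ∀ ψ : L2K N,
        ⟪F p s, ψ⟫_ℝ = (∫ y, A s y * sobolevEmb N (p s) y * ψ y ∂(measK N))
          + (∫ y, (∑ j, B s y j * sobolevGrad N (p s) j y) * ψ y ∂(measK N))
          - (N : ℝ) / 2 * ⟪sobolevEmb N (p s), ψ⟫_ℝ)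
  {φ : ℝ → Space N → ℝ} {Φ : Control N S} (hφ : ∀ᵐ s ∂(timeMeas S), φ s =ᵐ[measK N] Φ s)
  {v₀ : L2K N}
include hF hφ

theorem isWeakSolution_of_isMildSolution (hS : 0 ≤ S) {v : ℝ →ᵇ L2K N}
    {p : Lp (SobolevSpace N) 2 (timeMeas S)}
    (h : IsMildSolution (sobolevEmb N) (sobolevGrad N) v₀ (Φ - F p) v p) :
    IsWeakSolution S A B v₀ φ v := by
  have hv : ∀ᵐ s ∂(timeMeas S), sobolevEmb N (p s) = v s := by
    filter_upwards [coeFn_ofCont (S := S) v, (sobolevEmb N).coeFn_compLpL (p := 2) p] with s h1 h2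
    rw [← h1, h.1, h2]
  have hweak (ψ : SobolevSpace N) {s : ℝ} (hs : s ∈ Icc 0 S) := ae_weakForm_eq (hF p) hv
    (G := fun s j => sobolevGrad N (p s) j) (.of_forall fun _ _ => rfl) ψ hs
  refine ⟨v.continuous.continuousOn, ?_, fun s j => sobolevGrad N (p s) j, ?_, ?_, ?_⟩
  -- At s = 0 all primitives vanish. Density of H¹(K) in L²(K) then yields v(0) = v₀.
  · refine sub_eq_zero.1 ((isFormDomain_sobolev N).denseRange.eq_zero_of_inner_left ℝ fun ψ => ?_)
    have h1 := h.2 ψ 0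
    have h0 (X : Type) [NormedAddCommGroup X] [InnerProductSpace ℝ X] [CompleteSpace X]
        (f : Lp X 2 (timeMeas S)) : prim f 0 = 0 := by
      rw [prim_apply, setIntegral_Iic_timeMeas _ ⟨le_rfl, hS⟩, intervalIntegral.integral_same]
    rw [h0, h0, inner_zero_left, inner_zero_left] at h1
    rw [inner_sub_left]
    linarith
  · exact ((PiLp.continuousLinearEquiv 2 ℝ fun _ : Fin N => L2K N).toContinuousLinearMap ∘L
      sobolevGrad N).comp_memLp' (Lp.memLp p)
  · filter_upwards [hv] with s hs
    rw [← hs]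
    exact hasWeakGrad_sobolev (p s)
  · intro ψ Gψ hψ s hs
    obtain ⟨w, rfl, hw⟩ := exists_sobolev_eq hψ
    have h1 := hweak w hs
    have h2 := h.2 w s
    have h3 := integral_source_eq hφ (sobolevEmb N w) hs
    rw [map_sub, BoundedContinuousFunction.sub_apply, inner_sub_left] at h2
    simp only [hw] at h1
    rw [h1, h3]
    linarith

/-- Two adaptations are needed: v is extended by constants outside [0,S], and the pair (v, G), known
to lie in H¹(K) only for almost every s, is turned into a measurable H¹(K)-valued function. -/
theorem exists_isMildSolution_of_isWeakSolution (hS : 0 ≤ S) {v : ℝ → L2K N}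
    (h : IsWeakSolution S A B v₀ φ v) :
    ∃ (w : ℝ →ᵇ L2K N) (p : Lp (SobolevSpace N) 2 (timeMeas S)), EqOn v w (Icc 0 S) ∧
      IsMildSolution (sobolevEmb N) (sobolevGrad N) v₀ (Φ - F p) w p := by
  obtain ⟨hc, -, G, hG, hgrad, heq⟩ := h
  have hclamp (s : ℝ) : max 0 (min s S) ∈ Icc 0 S := ⟨le_max_left _ _, max_le hS (min_le_right _ _)⟩
  obtain ⟨C, hC⟩ := (isCompact_Icc.image_of_continuousOn hc).isBounded.exists_norm_le
  set w : ℝ →ᵇ L2K N := BoundedContinuousFunction.ofNormedAddCommGroup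
    (fun s => v (max 0 (min s S))) (hc.comp_continuous (by fun_prop) hclamp) C
    fun s => hC _ ⟨_, hclamp s, rfl⟩ with hw
  have hw_apply (s : ℝ) : w s = v (max 0 (min s S)) := rfl
  have hvw : EqOn v w (Icc 0 S) := fun s hs => by
    rw [hw_apply, min_eq_left hs.2, max_eq_right hs.1]
  set e := (WithLp.prodContinuousLinearEquiv 2 ℝ (L2K N)
    (PiLp 2 fun _ : Fin N => L2K N)).symm.toContinuousLinearMap
  -- Projecting (v, G) orthogonally onto H¹(K) is a continuous operation, so it preserves
  -- measurability and square integrability; it fixes the pair wherever G is the weak gradient of v.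
  set T₁ : L2K N →L[ℝ] SobolevSpace N := sobolevProj N ∘L e ∘L ContinuousLinearMap.inl ℝ _ _ with hT₁
  set T₂ : (Fin N → L2K N) →L[ℝ] SobolevSpace N := sobolevProj N ∘L e ∘L ContinuousLinearMap.inr ℝ _ _ ∘L
    (PiLp.continuousLinearEquiv 2 ℝ fun _ : Fin N => L2K N).symm.toContinuousLinearMap with hT₂
  set p : Lp (SobolevSpace N) 2 (timeMeas S) :=
    T₁.compLpL 2 _ (ofCont w) + T₂.compLpL 2 _ (hG.toLp G) with hp
  have hps : ∀ᵐ s ∂(timeMeas S), sobolevGraph N (p s) = WithLp.toLp 2 (v s, WithLp.toLp 2 (G s)) := by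
    filter_upwards [Lp.coeFn_add (T₁.compLpL 2 _ (ofCont w)) (T₂.compLpL 2 _ (hG.toLp G)),
      T₁.coeFn_compLpL (p := 2) (ofCont w : Control N S), coeFn_ofCont (S := S) w,
      T₂.coeFn_compLpL (p := 2) (hG.toLp G), hG.coeFn_toLp, hgrad,
      ae_restrict_mem measurableSet_Ioo] with s h1 h2 h3 h4 h5 h6 h7
    rw [hp, h1, Pi.add_apply, h2, h3, h4, h5, ← hvw ⟨h7.1.le, h7.2.le⟩, hT₁, hT₂]
    change sobolevGraph N (sobolevProj N (e (v s, 0)) + sobolevProj N (e (0, WithLp.toLp 2 (G s))))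
      = _
    rw [← map_add, ← map_add, Prod.mk_add_mk, add_zero, zero_add]
    exact sobolevGraph_proj (x := WithLp.toLp 2 (v s, WithLp.toLp 2 (G s))) h6
  have hv : ∀ᵐ s ∂(timeMeas S), sobolevEmb N (p s) = v s := by
    filter_upwards [hps] with s hs
    rw [sobolevEmb_apply, hs]
    rfl
  have hGs : ∀ᵐ s ∂(timeMeas S), ∀ j, sobolevGrad N (p s) j = G s j := by
    filter_upwards [hps] with s hs j
    rw [sobolevGrad_apply, hs]
    rfl
  refine ⟨w, p, hvw, ?_, fun ψ s => ?_⟩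
  · refine Lp.ext ?_
    filter_upwards [coeFn_ofCont (S := S) w, (sobolevEmb N).coeFn_compLpL (p := 2) p, hv,
      ae_restrict_mem measurableSet_Ioo] with s h1 h2 h3 h4
    rw [h1, h2, h3, hvw ⟨h4.1.le, h4.2.le⟩]
  · have hprim {X : Type} [NormedAddCommGroup X] [InnerProductSpace ℝ X] [CompleteSpace X]
        (f : Lp X 2 (timeMeas S)) : prim f s = prim f (max 0 (min s S)) := by
      rw [prim_apply, prim_apply, setIntegral_Iic_timeMeas_clamp hS,
        setIntegral_Iic_timeMeas _ (hclamp s)]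
    rw [hprim, hprim, hw_apply]
    have h1 := heq (sobolevEmb N ψ) (fun j => sobolevGrad N ψ j) (hasWeakGrad_sobolev ψ) _ (hclamp s)
    rw [ae_weakForm_eq (hF p) hv hGs ψ (hclamp s), integral_source_eq hφ _ (hclamp s)] at h1
    rw [map_sub, BoundedContinuousFunction.sub_apply, inner_sub_left]
    linarith

omit hF hφ in
/-- Well-posedness of the state equation, with a bounded linear solution operator. -/
theorem exists_stateOperator (hS : 0 < S)
    (hA : MemLp (fun p : ℝ × Space N => A p.1 p.2) ∞ ((timeMeas S).prod volume))
    (hB : MemLp (fun p : ℝ × Space N => B p.1 p.2) ∞ ((timeMeas S).prod volume)) :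
    ∃ T : WithLp 2 (L2K N × Control N S) →L[ℝ] (ℝ →ᵇ L2K N),
      ∀ (v₀ : L2K N) (φ : ℝ → Space N → ℝ) (Φ : Control N S),
        (∀ᵐ s ∂(timeMeas S), φ s =ᵐ[measK N] Φ s) →
        IsWeakSolution S A B v₀ φ (T (WithLp.toLp 2 (v₀, Φ))) ∧
        ∀ v, IsWeakSolution S A B v₀ φ v → EqOn v (T (WithLp.toLp 2 (v₀, Φ))) (Icc 0 S) := by
  obtain ⟨F, hF1, hF2⟩ := exists_lowerOrder (V := SobolevSpace N) (sobolevEmb N) (sobolevGrad N) hA hB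
  obtain ⟨T, hT⟩ := exists_solutionOperator (isFormDomain_sobolev N) hS.le F hF1
  refine ⟨T, fun v₀ φ Φ hφ => ?_⟩
  obtain ⟨⟨p, hp⟩, huniq⟩ := hT (WithLp.toLp 2 (v₀, Φ))
  refine ⟨isWeakSolution_of_isMildSolution hF2 hφ hS.le hp, fun v hv => ?_⟩
  obtain ⟨w, q, hvw, hw⟩ := exists_isMildSolution_of_isWeakSolution hF2 hφ hS.le hv
  rw [← huniq w q hw]
  exact hvw

end State

/-! ### The Nash operator -/

section MulOp

variable {X F : Type*} [MeasurableSpace X] {μ : Measure X} [NormedAddCommGroup F]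
  [InnerProductSpace ℝ F]

theorem inner_mulOp (m : Lp ℝ ∞ μ) (f g : Lp F 2 μ) :
    ⟪mulOp m f, g⟫_ℝ = ∫ x, m x * ⟪f x, g x⟫_ℝ ∂μ := by
  rw [L2.inner_def]
  refine integral_congr_ae ?_
  filter_upwards [coeFn_mulOp m f] with x hx
  rw [hx, inner_smul_left, conj_trivial]

theorem mulOp_symm (m : Lp ℝ ∞ μ) (f g : Lp F 2 μ) : ⟪mulOp m f, g⟫_ℝ = ⟪f, mulOp m g⟫_ℝ := by
  rw [real_inner_comm (mulOp m g), inner_mulOp, inner_mulOp]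
  simp only [real_inner_comm]

theorem norm_mulOp_le (m : Lp ℝ ∞ μ) (f : Lp F 2 μ) : ‖mulOp m f‖ ≤ ‖m‖ * ‖f‖ := by
  refine (ContinuousLinearMap.norm_holder_apply_apply_le _ m f).trans ?_
  have h : ‖(ContinuousLinearMap.lsmul ℝ ℝ : ℝ →L[ℝ] F →L[ℝ] F)‖ ≤ 1 :=
    ContinuousLinearMap.opNorm_lsmul_le
  have : ‖(ContinuousLinearMap.lsmul ℝ ℝ : ℝ →L[ℝ] F →L[ℝ] F)‖ * ‖m‖ ≤ 1 * ‖m‖ := by gcongr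
  rw [one_mul] at this
  gcongr

end MulOp

/-- A coercive bounded operator on a Hilbert space is invertible. -/
theorem isUnit_of_coercive {X : Type*} [NormedAddCommGroup X] [InnerProductSpace ℝ X]
    [CompleteSpace X] {T : X →L[ℝ] X} {c : ℝ} (hc : 0 < c)
    (hT : ∀ x, c * ‖x‖ ^ 2 ≤ ⟪T x, x⟫_ℝ) : IsUnit T := by
  set b : X →L[ℝ] X →L[ℝ] ℝ := (innerSL ℝ : X →L[ℝ] X →L[ℝ] ℝ) ∘L T with hb
  have hco : IsCoercive b := ⟨c, hc, fun x => by
    have := hT x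
    rw [sq, ← mul_assoc] at this
    exact this⟩
  -- Lax-Milgram represents the form ⟪Tx, y⟫ by an equivalence, and uniqueness of the representing
  -- operator identifies it with T.
  have h : (hco.continuousLinearEquivOfBilin : X →L[ℝ] X) = T := by
    ext x
    refine (hco.unique_continuousLinearEquivOfBilin fun w => ?_).symm
    rfl
  exact ⟨(ContinuousLinearEquiv.unitsEquiv ℝ X).symm hco.continuousLinearEquivOfBilin, h⟩

theorem eq_zero_of_forall_quadratic_nonneg {a q : ℝ} (h : ∀ t : ℝ, 0 ≤ t * a + t ^ 2 * q) :
    a = 0 := by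
  by_contra ha
  -- For small t of sign opposite to a the linear term dominates. The +1 avoids division by zero
  -- when q = 0.
  have h1 := h (-a / (2 * (|q| + 1)))
  have hq : 0 < |q| + 1 := by positivity
  have h2 : -a / (2 * (|q| + 1)) * a + (-a / (2 * (|q| + 1))) ^ 2 * q
      = a ^ 2 / (4 * (|q| + 1) ^ 2) * (q - 2 * (|q| + 1)) := by
    field_simp
    ring
  rw [h2] at h1
  have h3 : 0 < a ^ 2 / (4 * (|q| + 1) ^ 2) := by positivity
  have h4 : q - 2 * (|q| + 1) < 0 := by linarith [le_abs_self q, abs_nonneg q]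
  linarith [mul_neg_of_pos_of_neg h3 h4]

/-! ### Coercivity of 𝔏, and the costs as Hilbert space expressions -/

section Nash

variable {N n : ℕ} {S : ℝ}

variable (N S) in
/-- Multiplication by `|D_{y,s}|`. -/
def jacOp : Control N S →L[ℝ] Control N S := mulOp ((memLp_jacYS N S).toLp (jacYS N))

theorem coeFn_jacOp (h : Control N S) : jacOp N S h =ᵐ[timeMeas S] fun s => jacYS N s • h s := by
  filter_upwards [coeFn_mulOp ((memLp_jacYS N S).toLp (jacYS N)) h, (memLp_jacYS N S).coeFn_toLp]
    with s h1 h2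
  exact h1.trans (by rw [h2])

/-- The weight e^{-(N+2)s/2} decreases in s, so its value at s = S is a lower bound. -/
theorem jacOp_coercive (h : Control N S) :
    Real.exp (-((N : ℝ) + 2) * S / 2) * ‖h‖ ^ 2 ≤ ⟪jacOp N S h, h⟫_ℝ := by
  rw [norm_sq_Lp_two, ← integral_const_mul, L2.inner_def]
  refine integral_mono_ae (((Lp.memLp h).integrable_norm_pow (by norm_num)).const_mul _)
    (L2.integrable_inner (jacOp N S h) h) ?_
  filter_upwards [coeFn_jacOp h, ae_restrict_mem measurableSet_Ioo] with s h1 h2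
  rw [h1, inner_smul_left, conj_trivial, real_inner_self_eq_norm_sq, jacYS]
  have : ((N : ℝ) + 2) * s ≤ ((N : ℝ) + 2) * S := by gcongr; exact h2.2.le
  refine mul_le_mul_of_nonneg_right (Real.exp_le_exp.2 ?_) (by positivity)
  linarith

theorem jacOp_injective : Function.Injective (jacOp N S) := by
  refine (injective_iff_map_eq_zero _).2 fun h hh => ?_
  have := jacOp_coercive h
  rw [hh, inner_zero_left] at this
  have h1 : ‖h‖ ^ 2 ≤ 0 := nonpos_of_mul_nonpos_right this (Real.exp_pos _)
  simpa using le_antisymm h1 (by positivity)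

theorem jacOp_restrictRegion {U : Set (Space N)} (hU : IsOpen U) (h : Control N S) :
    jacOp N S (restrictRegion S hU h) = restrictRegion S hU (jacOp N S h) := by
  refine Lp.ext ?_
  filter_upwards [coeFn_jacOp (restrictRegion S hU h), coeFn_jacOp h,
    coeFn_fiberMul (measurable_regionInd hU) (norm_regionInd_le U) h,
    coeFn_fiberMul (measurable_regionInd hU) (norm_regionInd_le U) (jacOp N S h)]
    with s h1 h2 h3 h4
  rw [h1, restrictRegion, h3, h4, h2, map_smul]

theorem jacY_nonneg (N : ℕ) (S : ℝ) : 0 ≤ jacY N S := (Real.exp_pos _).le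

variable (L : Fin n → Control N S →L[ℝ] L2K N) (α : Fin n → ℝ) (ρ : Fin n → LinftyK N)

theorem nashOp_apply (h : Controls N S n) (i : Fin n) :
    nashOp L α ρ h i = jacOp N S (h i) + α i • weightedAdjoint (L i) (ρ i) (∑ j, L j (h j)) := by
  simp [nashOp, jacOp]

theorem inner_weightedAdjoint (M : Control N S →L[ℝ] L2K N) (r : LinftyK N) (u : L2K N)
    (k : Control N S) :
    ⟪weightedAdjoint M r u, k⟫_ℝ = jacY N S * ⟪mulOp r u, mulOp r (M k)⟫_ℝ := by
  rw [weightedAdjoint, ContinuousLinearMap.comp_apply, ContinuousLinearMap.adjoint_inner_left,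
    smul_apply, inner_smul_left, conj_trivial, ContinuousLinearMap.comp_apply, mulOp_symm]

/-- The i-th coupling term is at least -ε a ‖L_i‖‖h_i‖ with a = ∑‖L_j‖‖h_j‖. Summing over i gives -ε
a², and Cauchy-Schwarz gives a² ≤ Λ‖h‖². The bound on ε makes this loss at most (δ/2)‖h‖²; the +1 in
its denominator covers Λ = 0. -/
theorem nashOp_coercive (hα : ∀ i, 0 < α i) (hε : ∀ i, α i * jacY N S * ‖ρ i‖ ^ 2
      ≤ Real.exp (-((N : ℝ) + 2) * S / 2) / (2 * (∑ j, ‖L j‖ ^ 2 + 1))) (h : Controls N S n) :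
    Real.exp (-((N : ℝ) + 2) * S / 2) / 2 * ‖h‖ ^ 2 ≤ ⟪nashOp L α ρ h, h⟫_ℝ := by
  set δ := Real.exp (-((N : ℝ) + 2) * S / 2) with hδ
  set Λ := ∑ j, ‖L j‖ ^ 2 with hΛ
  have hδ0 : 0 < δ := Real.exp_pos _
  have hΛ0 : 0 ≤ Λ := by positivity
  set ε := δ / (2 * (Λ + 1)) with hεdef
  have hε0 : 0 < ε := by positivity
  set u := ∑ j, L j (h j) with hu
  set a := ∑ j, ‖L j‖ * ‖h j‖ with ha
  have ha0 : 0 ≤ a := by positivity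
  have hua : ‖u‖ ≤ a := (norm_sum_le _ _).trans (Finset.sum_le_sum fun j _ => (L j).le_opNorm _)
  have hnorm : ‖h‖ ^ 2 = ∑ i, ‖h i‖ ^ 2 := PiLp.norm_sq_eq_of_L2 _ h
  have ha2 : a ^ 2 ≤ Λ * ‖h‖ ^ 2 := by
    rw [hnorm]
    exact Finset.sum_mul_sq_le_sq_mul_sq _ _ _
  have hterm (i : Fin n) : δ * ‖h i‖ ^ 2 - ε * a * (‖L i‖ * ‖h i‖)
      ≤ ⟪nashOp L α ρ h i, h i⟫_ℝ := by
    rw [nashOp_apply, inner_add_left, inner_smul_left, conj_trivial, inner_weightedAdjoint]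
    have h1 := jacOp_coercive (h i)
    have h2 : |⟪mulOp (ρ i) u, mulOp (ρ i) (L i (h i))⟫_ℝ|
        ≤ ‖ρ i‖ ^ 2 * (a * (‖L i‖ * ‖h i‖)) := by
      calc |⟪mulOp (ρ i) u, mulOp (ρ i) (L i (h i))⟫_ℝ|
          ≤ ‖mulOp (ρ i) u‖ * ‖mulOp (ρ i) (L i (h i))‖ := abs_real_inner_le_norm _ _
        _ ≤ (‖ρ i‖ * a) * (‖ρ i‖ * (‖L i‖ * ‖h i‖)) := by
            gcongr
            · exact (norm_mulOp_le _ _).trans (by gcongr)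
            · exact (norm_mulOp_le _ _).trans (by gcongr; exact (L i).le_opNorm _)
        _ = _ := by ring
    have h3 := neg_abs_le ⟪mulOp (ρ i) u, mulOp (ρ i) (L i (h i))⟫_ℝ
    have h4 : 0 ≤ α i * jacY N S := mul_nonneg (hα i).le (jacY_nonneg N S)
    have h5 : α i * jacY N S * -(‖ρ i‖ ^ 2 * (a * (‖L i‖ * ‖h i‖)))
        ≤ α i * jacY N S * ⟪mulOp (ρ i) u, mulOp (ρ i) (L i (h i))⟫_ℝ := by
      gcongr
      linarith
    have h6 : α i * jacY N S * ‖ρ i‖ ^ 2 * (a * (‖L i‖ * ‖h i‖)) ≤ ε * (a * (‖L i‖ * ‖h i‖)) := by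
      gcongr
      exact hε i
    linarith
  have hsum : δ * ‖h‖ ^ 2 - ε * a ^ 2 ≤ ⟪nashOp L α ρ h, h⟫_ℝ := by
    rw [PiLp.inner_apply]
    refine le_trans (le_of_eq ?_) (Finset.sum_le_sum fun i _ => hterm i)
    rw [Finset.sum_sub_distrib, ← Finset.mul_sum, ← Finset.mul_sum, ← hnorm, ← ha]
    ring
  have h7 : ε * a ^ 2 ≤ δ / 2 * ‖h‖ ^ 2 := by
    calc ε * a ^ 2 ≤ ε * ((Λ + 1) * ‖h‖ ^ 2) := by
          gcongr
          nlinarith [sq_nonneg ‖h‖]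
      _ = δ / 2 * ‖h‖ ^ 2 := by rw [hεdef]; field_simp
  linarith

/-- Two controls have the same restriction to the region exactly if they agree there. -/
theorem restrictRegion_eq_iff {U : Set (Space N)} (hU : IsOpen U) {h k : Control N S} :
    restrictRegion S hU h = restrictRegion S hU k ↔
      ∀ᵐ s ∂(timeMeas S), ∀ᵐ y ∂(measK N), y ∈ region U s → h s y = k s y := by
  constructor
  · intro he
    filter_upwards [ae_ae_restrictRegion hU h, ae_ae_restrictRegion hU k] with s h1 h2
    rw [he] at h1
    filter_upwards [h1, h2] with y h3 h4 hy
    rw [h3] at h4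
    simpa [localize, hy] using h4
  · intro he
    refine Lp.ext ?_
    filter_upwards [ae_ae_restrictRegion hU h, ae_ae_restrictRegion hU k, he] with s h1 h2 h3
    refine Lp.ext ?_
    filter_upwards [h1, h2, h3] with y h4 h5 h6
    rw [h4, h5]
    by_cases hy : y ∈ region U s
    · simp [localize, hy, h6 hy]
    · simp [localize, hy]

theorem ae_eq_zero_of_restrictRegion_eq_self {U : Set (Space N)} (hU : IsOpen U)
    {h : Control N S} (hh : restrictRegion S hU h = h) :
    ∀ᵐ s ∂(timeMeas S), ∀ᵐ y ∂(measK N), y ∉ region U s → h s y = 0 := by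
  filter_upwards [ae_ae_restrictRegion hU h] with s h1
  rw [hh] at h1
  filter_upwards [h1] with y h2 hy
  rw [h2]
  simp [localize, hy]

theorem integral_control_cost {U : Set (Space N)} (hU : IsOpen U) (k : Control N S) :
    ∫ s in Ioo 0 S, ∫ y in region U s, jacYS N s * (k s y) ^ 2 ∂(measK N)
      = ⟪jacOp N S (restrictRegion S hU k), restrictRegion S hU k⟫_ℝ := by
  rw [L2.inner_def]
  refine integral_congr_ae ?_
  filter_upwards [coeFn_jacOp (restrictRegion S hU k), ae_ae_restrictRegion hU k] with s h1 h2
  rw [h1, inner_smul_left, conj_trivial, integral_const_mul, inner_L2K,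
    ← integral_indicator (measurableSet_region hU s)]
  congr 1
  refine integral_congr_ae ?_
  filter_upwards [h2] with y h3
  rw [h3]
  by_cases hy : y ∈ region U s
  · simp [localize, hy, sq]
  · simp [localize, hy]

theorem integral_state_cost (r : LinftyK N) (w vS : L2K N) :
    ∫ y, jacY N S * (r y) ^ 2 * (w y - vS y) ^ 2 ∂(measK N)
      = jacY N S * ‖mulOp r (w - vS)‖ ^ 2 := by
  rw [norm_sq_Lp_two, ← integral_const_mul]
  refine integral_congr_ae ?_
  filter_upwards [coeFn_mulOp r (w - vS), Lp.coeFn_sub w vS] with y h1 h2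
  rw [h1, h2, Pi.sub_apply, norm_smul, mul_pow, Real.norm_eq_abs, sq_abs, Real.norm_eq_abs, sq_abs,
    mul_assoc]

end Nash

/-! ### Nash equilibria -/

section Equilibrium

variable {N n : ℕ} {S : ℝ} {Oi : Fin n → Set (Space N)} (hOi : ∀ i, IsOpen (Oi i))
  (L : Fin n → Control N S →L[ℝ] L2K N) (α : Fin n → ℝ) (ρ : Fin n → LinftyK N) (z vS : L2K N)

/-- The cost of the `i`-th follower when the final state is `z + ∑ L_j h_j`. -/
def reducedCost (i : Fin n) (h : Fin n → Control N S) : ℝ :=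
  1 / 2 * ⟪jacOp N S (restrictRegion S (hOi i) (h i)), restrictRegion S (hOi i) (h i)⟫_ℝ
    + α i / 2 * (jacY N S * ‖mulOp (ρ i) (z + ∑ j, L j (h j) - vS)‖ ^ 2)

/-- The gradient of the `i`-th cost with respect to the `i`-th control. -/
def costGrad (i : Fin n) (h : Fin n → Control N S) : Control N S :=
  jacOp N S (restrictRegion S (hOi i) (h i))
    + α i • weightedAdjoint (L i) (ρ i) (z + ∑ j, L j (h j) - vS)

/-- The quadratic part of the `i`-th cost with respect to the `i`-th control. -/
def costQuad (i : Fin n) (w : Control N S) : ℝ :=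
  1 / 2 * ⟪jacOp N S (restrictRegion S (hOi i) w), restrictRegion S (hOi i) w⟫_ℝ
    + α i / 2 * (jacY N S * ‖mulOp (ρ i) (L i w)‖ ^ 2)

theorem sum_update_add (h : Fin n → Control N S) (i : Fin n) (w : Control N S) :
    ∑ j, L j (Function.update h i (h i + w) j) = ∑ j, L j (h j) + L i w := by
  have (j : Fin n) : L j (Function.update h i (h i + w) j)
      = L j (h j) + if j = i then L i w else 0 := by
    by_cases hj : j = i
    · subst hj
      simp
    · simp [hj]
  simp only [this, Finset.sum_add_distrib, Finset.sum_ite_eq', Finset.mem_univ, if_true]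

theorem inner_jacOp_restrictRegion {U : Set (Space N)} (hU : IsOpen U) (h k : Control N S) :
    ⟪jacOp N S (restrictRegion S hU h), restrictRegion S hU k⟫_ℝ
      = ⟪jacOp N S (restrictRegion S hU h), k⟫_ℝ := by
  rw [← restrictRegion_symm, ← jacOp_restrictRegion, restrictRegion_idem]

/-- The final state is affine in h_i, so the second order Taylor expansion is exact. -/
theorem reducedCost_update (i : Fin n) (h : Fin n → Control N S) (w : Control N S) :
    reducedCost hOi L α ρ z vS i (Function.update h i (h i + w))
      = reducedCost hOi L α ρ z vS i h + ⟪costGrad hOi L α ρ z vS i h, w⟫_ℝ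
        + costQuad hOi L α ρ i w := by
  have h1 : z + (∑ j, L j (h j) + L i w) - vS = (z + ∑ j, L j (h j) - vS) + L i w := by abel
  have h2 : ⟪jacOp N S (restrictRegion S (hOi i) w), restrictRegion S (hOi i) (h i)⟫_ℝ
      = ⟪jacOp N S (restrictRegion S (hOi i) (h i)), w⟫_ℝ := by
    rw [← inner_jacOp_restrictRegion (hOi i) (h i) w, jacOp, mulOp_symm, real_inner_comm]
  rw [reducedCost, sum_update_add, Function.update_self, h1, reducedCost, costGrad, costQuad,
    map_add (restrictRegion S (hOi i)), map_add (jacOp N S), map_add (mulOp (ρ i)),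
    norm_add_sq_real, inner_add_left, inner_add_right, inner_add_right, h2, inner_add_left,
    inner_smul_left, conj_trivial, inner_weightedAdjoint, inner_jacOp_restrictRegion _ (h i) w]
  ring

theorem costQuad_smul (i : Fin n) (t : ℝ) (w : Control N S) :
    costQuad hOi L α ρ i (t • w) = t ^ 2 * costQuad hOi L α ρ i w := by
  simp only [costQuad, map_smul, inner_smul_left, inner_smul_right, conj_trivial, norm_smul,
    mul_pow, Real.norm_eq_abs, sq_abs]
  ring

theorem costQuad_nonneg (hα : ∀ i, 0 < α i) (i : Fin n) (w : Control N S) :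
    0 ≤ costQuad hOi L α ρ i w := by
  have h1 := jacOp_coercive (restrictRegion S (hOi i) w)
  have h2 : 0 ≤ ⟪jacOp N S (restrictRegion S (hOi i) w), restrictRegion S (hOi i) w⟫_ℝ :=
    le_trans (by positivity) h1
  have h3 := jacY_nonneg N S
  have h4 := (hα i).le
  rw [costQuad]
  positivity

/-- Necessity follows by varying h_i along its own gradient. Sufficiency is convexity: α_i > 0 makes
the quadratic part nonnegative. -/
theorem isMin_reducedCost_iff (hα : ∀ i, 0 < α i) (h : Fin n → Control N S) :
    (∀ i k, reducedCost hOi L α ρ z vS i h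
        ≤ reducedCost hOi L α ρ z vS i (Function.update h i k))
      ↔ ∀ i, costGrad hOi L α ρ z vS i h = 0 := by
  constructor
  · intro hmin i
    set γ := costGrad hOi L α ρ z vS i h with hγ
    have hq (t : ℝ) : 0 ≤ t * ‖γ‖ ^ 2 + t ^ 2 * costQuad hOi L α ρ i γ := by
      have h1 := hmin i (h i + t • γ)
      rw [reducedCost_update, costQuad_smul, inner_smul_right, ← hγ,
        real_inner_self_eq_norm_sq] at h1
      linarith
    simpa using eq_zero_of_forall_quadratic_nonneg hq
  · intro hzero i k
    have h1 := reducedCost_update hOi L α ρ z vS i h (k - h i)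
    rw [add_sub_cancel, hzero i, inner_zero_left] at h1
    linarith [costQuad_nonneg hOi L α ρ hα i (k - h i)]

variable {L α ρ z vS}
  (hL : ∀ i k, L i (restrictRegion S (hOi i) k) = L i k)
include hL

/-- Dualising L_i = L_i χ_i, with χ_i self-adjoint, gives L_i* = χ_i L_i*. -/
theorem restrictRegion_weightedAdjoint (i : Fin n) (u : L2K N) :
    restrictRegion S (hOi i) (weightedAdjoint (L i) (ρ i) u) = weightedAdjoint (L i) (ρ i) u := by
  refine ext_inner_right ℝ fun k => ?_
  rw [restrictRegion_symm, inner_weightedAdjoint, inner_weightedAdjoint, hL]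

/-- Since L_j χ_j = L_j, the i-th component of 𝔏(χh) - ξ is exactly the i-th gradient at h. Values
of h outside the regions play no role. -/
theorem nashOp_restrictRegion_eq_iff (h : Fin n → Control N S) :
    nashOp L α ρ (WithLp.toLp 2 fun i => restrictRegion S (hOi i) (h i))
        = nashRhs L α ρ (vS - z)
      ↔ ∀ i, costGrad hOi L α ρ z vS i h = 0 := by
  have key (i : Fin n) : nashOp L α ρ (WithLp.toLp 2 fun i => restrictRegion S (hOi i) (h i)) i
      - nashRhs L α ρ (vS - z) i = costGrad hOi L α ρ z vS i h := by
    rw [nashOp_apply, nashRhs, costGrad]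
    simp only [hL]
    rw [add_sub_assoc, ← smul_sub, ← map_sub]
    congr 3
    abel
  constructor
  · intro he i
    rw [← key i, he, sub_self]
  · intro hz
    ext1 i
    rw [← sub_eq_zero, key i, hz i]

/-- The equation expresses |D_{y,s}| h_i through the range of L_i*, which is supported in the
region. The weight commutes with restriction and is injective, so h_i has the same support. -/
theorem restrictRegion_eq_self_of_nashOp_eq {h : Controls N S n}
    (hh : nashOp L α ρ h = nashRhs L α ρ (vS - z)) (i : Fin n) :
    restrictRegion S (hOi i) (h i) = h i := by
  have h1 : nashOp L α ρ h i = nashRhs L α ρ (vS - z) i := by rw [hh]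
  rw [nashOp_apply, nashRhs, ← eq_sub_iff_add_eq] at h1
  have h2 : jacOp N S (h i)
      = α i • weightedAdjoint (L i) (ρ i) (vS - z - ∑ j, L j (h j)) := by
    rw [h1, map_sub _ _ (∑ j, L j (h j)), smul_sub]
  refine jacOp_injective ?_
  rw [jacOp_restrictRegion, h2, map_smul, restrictRegion_weightedAdjoint hOi hL]

end Equilibrium

end StackelbergNash

end

/-! ### Assembly of the theorem -/

open StackelbergNash in
theorem theorem4p1 {N n : ℕ} (hN : 1 ≤ N) {S : ℝ} (hS : 0 < S)
    (A : ℝ → Space N → ℝ) (B : ℝ → Space N → Space N)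
    (hA : MemLp (fun p : ℝ × Space N => A p.1 p.2) ∞ ((timeMeas S).prod volume))
    (hB : MemLp (fun p : ℝ × Space N => B p.1 p.2) ∞ ((timeMeas S).prod volume))
    (O : Set (Space N)) (hO : IsOpen O)
    (Oi : Fin n → Set (Space N)) (hOi : ∀ i, IsOpen (Oi i)) :
    -- the state equation is well posed for all data and controls
    (∀ (v₀ : L2K N) (g : Control N S) (h : Fin n → Control N S),
      ∃ v, IsWeakSolution S A B v₀ (source O Oi g h) v ∧
        ∀ v', IsWeakSolution S A B v₀ (source O Oi g h) v' → EqOn v' v (Icc 0 S)) ∧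
    -- the control-to-final-state maps are bounded linear operators
    ∃ L : Fin n → (Control N S →L[ℝ] L2K N),
      (∀ i k, L i k = finalState S A B 0 (localize (Oi i) k)) ∧
      ∃ ε : ℝ, 0 < ε ∧
        ∀ (α : Fin n → ℝ) (ρ : Fin n → LinftyK N),
          (∀ i, 0 < α i) → (∀ i, 0 ≤ ρ i) →
          (∀ i, α i * jacY N S * ‖ρ i‖ ^ 2 ≤ ε) →
          -- coercivity
          (∃ c : ℝ, 0 < c ∧
            ∀ h : Controls N S n, c * ‖h‖ ^ 2 ≤ inner ℝ (nashOp L α ρ h) h) ∧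
          -- invertibility
          IsUnit (nashOp L α ρ) ∧
          -- existence and uniqueness of the Nash equilibrium
          ∀ (v₀ vS : L2K N) (g : Control N S),
            ∃ h : Controls N S n,
              nashOp L α ρ h
                = nashRhs L α ρ (vS - finalState S A B v₀ (localize O g)) ∧
              (∀ i, ∀ᵐ s ∂(timeMeas S), ∀ᵐ y ∂(measK N),
                y ∉ region (Oi i) s → h i s y = 0) ∧
              ∀ h' : Fin n → Control N S,
                IsNash A B O Oi α ρ v₀ vS g h' ↔
                  ∀ i, ∀ᵐ s ∂(timeMeas S), ∀ᵐ y ∂(measK N),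
                    y ∈ region (Oi i) s → h' i s y = h i s y := by
  obtain ⟨T, hT⟩ := exists_stateOperator hS hA hB
  -- `finalState` is a choice. Existence makes its defining property available, and uniqueness on
  -- [0,S] identifies it with the operator `T` evaluated at S.
  have hfinal (v₀ : L2K N) (φ : ℝ → Space N → ℝ) (Φ : Control N S)
      (hφ : ∀ᵐ s ∂(timeMeas S), φ s =ᵐ[measK N] Φ s) :
      finalState S A B v₀ φ = T (WithLp.toLp 2 (v₀, Φ)) S := by
    obtain ⟨h1, h2⟩ := hT v₀ φ Φ hφ
    obtain ⟨v, hv, hvS⟩ := Classical.epsilon_spec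
      (p := fun w => ∃ v, IsWeakSolution S A B v₀ φ v ∧ v S = w) ⟨_, _, h1, rfl⟩
    exact hvS.symm.trans (h2 v hv (right_mem_Icc.2 hS.le))
  refine ⟨fun v₀ g h => ⟨_, hT v₀ _ _ (ae_ae_source hO hOi g h)⟩, ?_⟩
  set Sig : WithLp 2 (L2K N × Control N S) →L[ℝ] L2K N :=
    BoundedContinuousFunction.evalCLM ℝ S ∘L T with hSig
  set L : Fin n → (Control N S →L[ℝ] L2K N) := fun i =>
    Sig ∘L (WithLp.prodContinuousLinearEquiv 2 ℝ (L2K N) (Control N S)).symm.toContinuousLinearMap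
      ∘L ContinuousLinearMap.inr ℝ (L2K N) (Control N S) ∘L restrictRegion S (hOi i) with hLdef
  have hLapp (i : Fin n) (k : Control N S) :
      L i k = Sig (WithLp.toLp 2 (0, restrictRegion S (hOi i) k)) := rfl
  have hLχ (i : Fin n) (k : Control N S) : L i (restrictRegion S (hOi i) k) = L i k := by
    rw [hLapp, hLapp, restrictRegion_idem]
  -- ε is fixed before α and ρ; it involves only N, S and the norms of the L_j.
  refine ⟨L, fun i k => ?_, Real.exp (-((N : ℝ) + 2) * S / 2) / (2 * (∑ j, ‖L j‖ ^ 2 + 1)),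
    by positivity, fun α ρ hα _ hε => ?_⟩
  · rw [hfinal 0 _ _ (by
      filter_upwards [ae_ae_restrictRegion (hOi i) k] with s hs using hs.symm)]
    rfl
  have hcoer := nashOp_coercive L α ρ hα hε
  have hc : 0 < Real.exp (-((N : ℝ) + 2) * S / 2) / 2 := by positivity
  have hunit := isUnit_of_coercive hc hcoer
  refine ⟨⟨_, hc, hcoer⟩, hunit, fun v₀ vS g => ?_⟩
  set z := finalState S A B v₀ (localize O g) with hz
  have hz' : z = Sig (WithLp.toLp 2 (v₀, restrictRegion S hO g)) :=
    hfinal v₀ _ _ (by filter_upwards [ae_ae_restrictRegion hO g] with s hs using hs.symm)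
  have hstate (h : Fin n → Control N S) :
      finalState S A B v₀ (source O Oi g h) = z + ∑ j, L j (h j) := by
    rw [hfinal v₀ _ _ (ae_ae_source hO hOi g h), hz']
    simp only [hLapp, ← map_sum, ← map_add]
    have e : ∑ j, (WithLp.toLp 2 (0, restrictRegion S (hOi j) (h j)) :
        WithLp 2 (L2K N × Control N S))
        = WithLp.toLp 2 (0, ∑ j, restrictRegion S (hOi j) (h j)) := by
      have := map_sum ((WithLp.prodContinuousLinearEquiv 2 ℝ (L2K N)
        (Control N S)).symm.toContinuousLinearMap ∘L
          ContinuousLinearMap.inr ℝ (L2K N) (Control N S))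
        (fun j => restrictRegion S (hOi j) (h j)) Finset.univ
      exact this.symm
    rw [e, ← WithLp.toLp_add, Prod.mk_add_mk, add_zero]
    rfl
  have hcost (i : Fin n) (h : Fin n → Control N S) :
      cost A B O Oi α ρ v₀ vS g i h = reducedCost hOi L α ρ z vS i h := by
    rw [cost, integral_control_cost (hOi i), integral_state_cost, hstate, reducedCost]
  obtain ⟨U, hU⟩ := hunit
  have hinj : Function.Injective (nashOp L α ρ) := by
    intro x y hxy
    have h1 (x) : (↑U⁻¹ : Controls N S n →L[ℝ] Controls N S n) (nashOp L α ρ x) = x := by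
      rw [← hU]
      exact congrArg (fun T : Controls N S n →L[ℝ] _ => T x) U.inv_mul
    rw [← h1 x, hxy, h1]
  have hsol : nashOp L α ρ ((↑U⁻¹ : Controls N S n →L[ℝ] Controls N S n) (nashRhs L α ρ (vS - z)))
      = nashRhs L α ρ (vS - z) := by
    rw [← hU]
    exact congrArg (fun T : Controls N S n →L[ℝ] _ => T _) U.mul_inv
  set h := (↑U⁻¹ : Controls N S n →L[ℝ] Controls N S n) (nashRhs L α ρ (vS - z))
  have hself := restrictRegion_eq_self_of_nashOp_eq hOi hLχ hsol
  refine ⟨h, hsol, fun i => ae_eq_zero_of_restrictRegion_eq_self (hOi i) (hself i), fun h' => ?_⟩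
  simp only [IsNash, hcost]
  -- The equilibrium condition becomes 𝔏(χh') = 𝔏h, hence χh' = h by injectivity. As h = χh, this is
  -- agreement on the regions.
  rw [isMin_reducedCost_iff hOi L α ρ z vS hα h', ← nashOp_restrictRegion_eq_iff hOi hLχ, ← hsol,
    hinj.eq_iff]
  simp only [← restrictRegion_eq_iff (hOi _), hself]
  constructor
  · intro he i
    rw [← he]
  · intro he
    ext1 i
    exact he i
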